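/- Let $n\ge 1$ be an integer and let $s>1$, $0<\alpha<n/s$, $0<r\le s$, $p>1$, $p'=p/(p-1)$. For a nonnegative measurable $f$ on $\mathbb{R}^n$ let $$I_\alpha f(x)=\gamma(n,\alpha)\int_{\mathbb{R}^n}|x-y|^{\alpha-n}f(y)\,dy,\qquad \gamma(n,\alpha)=\frac{\Gamma(\frac{n-\alpha}{2})}{\pi^{n/2}2^{\alpha}\Gamma(\frac{\alpha}{2})},$$ and for $E\subset\mathbb{R}^n$ let $\mathrm{cap}_{\alpha,s}(E)=\inf\{\|f\|_{L^s}^s: f\ge 0,\ I_\alpha f\ge 1 \text{ on } E\}$. A property holds quasi-everywhere (q.e.) if it holds outside a set of zero $\mathrm{cap}_{\alpha,s}$. For a q.e. defined function $u$ let $$\|u\|_{\dot F}=\inf\{\|f\|_{L^s}^r: f\ge 0,\ I_\alpha f\ge |u|^{1/r}\text{ q.e.}\}\qquad(\inf\emptyset=+\infty).$$ A weight is a nonnegative locally integrable function. Let $\dot{\overline N}{}^{\alpha,s}_{p',s/r}$ be the space of all measurable functions $g$ on $\mathbb{R}^n$ with $\|g\|_{\dot{\overline N}{}^{\alpha,s}_{p',s/r}}<\infty$,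 where $$\|g\|_{\dot{\overline N}{}^{\alpha,s}_{p',s/r}}=\inf_w\Big(\int_{\{g\neq 0\}}|g|^{p'}w^{1-p'}dx\Big)^{1/p'},$$ the infimum being taken over all q.e. defined weights $w$ with $\|w\|_{\dot F}\le 1$. **Theorem.** The space $\dot{\overline N}{}^{\alpha,s}_{p',s/r}$ is a Banach function space in the sense of Luxemburg, that is, it consists of all measurable $f$ with $\|f\|=\rho(|f|)<\infty$ for a functional $\rho$ on nonnegative measurable functions, with values in $[0,\infty]$, such that 1. $\rho(f)=0$ if and only if $f=0$ a.e.; $\rho(f_1+f_2)\le\rho(f_1)+\rho(f_2)$; $\rho(\lambda f)=\lambda\rho(f)$ for every constant $\lambda\ge0$; 2. (Fatou property) if $f_j\ge0$ are measurable and $f_j\uparrow f$ a.e., then $\rho(f_j)\uparrow\rho(f)$; 3. $\rho(\chi_E)<\infty$ for every bounded measurable $E\subset\mathbb{R}^n$; 4. for every bounded measurable $E$ there is a finite constant $A_E\ge 0$ with $\int_E f\,dx\le A_E\,\rho(f)$ for all nonnegative measurable $f$. In particular the norm of $\dot{\overline N}{}^{\alpha,s}_{p',s/r}$ has the Fatou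 property: if $g_j\ge0$ are measurable and $g_j\uparrow g$ a.e., then $\|g_j\|_{\dot{\overline N}{}^{\alpha,s}_{p',s/r}}\uparrow\|g\|_{\dot{\overline N}{}^{\alpha,s}_{p',s/r}}$. -/

import Mathlib

open MeasureTheory Filter Topology
open scoped ENNReal NNReal

namespace RieszBFS

noncomputable section

/-- The normalizing constant of the Riesz kernel,
`γ(n, α) = Γ((n - α) / 2) / (π ^ (n / 2) 2 ^ α Γ(α / 2))`. -/
def rieszConst (n : ℕ) (α : ℝ) : ℝ :=
  Real.Gamma ((n - α) / 2) / (Real.pi ^ ((n : ℝ) / 2) * 2 ^ α * Real.Gamma (α / 2))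

/-- The Riesz potential `I_α f (x) = γ(n, α) ∫ |x - y| ^ (α - n) f(y) dy` of a nonnegative
function, with values in `[0, ∞]`. -/
def rieszPotential {n : ℕ} (α : ℝ) (f : EuclideanSpace ℝ (Fin n) → ℝ≥0∞)
    (x : EuclideanSpace ℝ (Fin n)) : ℝ≥0∞ :=
  ENNReal.ofReal (rieszConst n α) * ∫⁻ y, ‖x - y‖ₑ ^ (α - n) * f y

/-- The Riesz capacity `cap_{α,s}(A) = inf { ‖f‖_{L^s} ^ s : f ≥ 0, I_α f ≥ 1 on A }`, defined for
every set `A`. Here and below `AEMeasurable` (with respect to Lebesgue measure) means Lebesgue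
measurable. -/
def rieszCap {n : ℕ} (α s : ℝ) (A : Set (EuclideanSpace ℝ (Fin n))) : ℝ≥0∞ :=
  ⨅ (f : EuclideanSpace ℝ (Fin n) → ℝ≥0∞) (_ : AEMeasurable f volume)
    (_ : ∀ x ∈ A, 1 ≤ rieszPotential α f x), ∫⁻ x, f x ^ s

/-- `P` holds quasi-everywhere: outside a set of zero `cap_{α,s}`-capacity. -/
def QuasiEverywhere {n : ℕ} (α s : ℝ) (P : EuclideanSpace ℝ (Fin n) → Prop) : Prop :=
  rieszCap α s {x | ¬ P x} = 0

/-- The norm `‖u‖_F = inf { ‖f‖_{L^s} ^ r : f ≥ 0, I_α f ≥ |u| ^ (1 / r) q.e. }` of a function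
`u : ℝⁿ → [0, ∞]`; the infimum over the empty set is `∞`. It does not see the values of `u` on a
set of zero capacity, so a quasi-everywhere defined function is represented by any extension of it
to the whole space. -/
def fNorm {n : ℕ} (α s r : ℝ) (u : EuclideanSpace ℝ (Fin n) → ℝ≥0∞) : ℝ≥0∞ :=
  ⨅ (f : EuclideanSpace ℝ (Fin n) → ℝ≥0∞) (_ : AEMeasurable f volume)
    (_ : QuasiEverywhere α s (fun x => u x ^ (1 / r) ≤ rieszPotential α f x)),
    (∫⁻ x, f x ^ s) ^ (r / s)

/-- The functional `inf_w (∫ g ^ q w ^ (1 - q) dx) ^ (1 / q)` on functions `g : ℝⁿ → [0, ∞]`, the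
infimum being over all weights `w` (nonnegative locally integrable functions) with `‖w‖_F ≤ 1`.
Since `0 * ∞ = 0` in `[0, ∞]` and `0 ^ q = 0` for `q > 0`, the integral is the one over
`{g ≠ 0}`; since `0 ^ (1 - q) = ∞` for `q > 1`, its finiteness forces `g = 0` a.e. on `{w = 0}`. -/
def nbarMetric {n : ℕ} (α s r q : ℝ) (g : EuclideanSpace ℝ (Fin n) → ℝ≥0∞) : ℝ≥0∞ :=
  ⨅ (w : EuclideanSpace ℝ (Fin n) → ℝ≥0∞) (_ : LocallyIntegrable w volume)
    (_ : fNorm α s r w ≤ 1), (∫⁻ x, g x ^ q * w x ^ (1 - q)) ^ (1 / q)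

/-- The norm of a real function `g`, with values in `[0, ∞]`. -/
def nbarNorm {n : ℕ} (α s r q : ℝ) (g : EuclideanSpace ℝ (Fin n) → ℝ) : ℝ≥0∞ :=
  nbarMetric α s r q (fun x => ‖g x‖ₑ)

/-- The space of all Lebesgue measurable functions of finite norm. -/
def nbarSpace (n : ℕ) (α s r q : ℝ) : Set (EuclideanSpace ℝ (Fin n) → ℝ) :=
  {g | AEMeasurable g volume ∧ nbarNorm α s r q g < ∞}

/-- Metric functions (function norms) in the sense of Luxemburg, on the nonnegative Lebesgue
measurable functions on `ℝⁿ`. -/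
structure IsFunctionMetric {n : ℕ}
    (ρ : (EuclideanSpace ℝ (Fin n) → ℝ≥0∞) → ℝ≥0∞) : Prop where
  eq_zero_iff : ∀ f, AEMeasurable f volume → (ρ f = 0 ↔ f =ᵐ[volume] 0)
  add_le : ∀ f₁ f₂, AEMeasurable f₁ volume → AEMeasurable f₂ volume →
    ρ (fun x => f₁ x + f₂ x) ≤ ρ f₁ + ρ f₂
  const_mul : ∀ (c : ℝ≥0) (f), AEMeasurable f volume → ρ (fun x => c * f x) = c * ρ f
  /-- The Fatou property. -/
  fatou : ∀ (f : ℕ → EuclideanSpace ℝ (Fin n) → ℝ≥0∞) (g : EuclideanSpace ℝ (Fin n) → ℝ≥0∞),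
    (∀ j, AEMeasurable (f j) volume) →
    (∀ᵐ x, Monotone (fun j => f j x) ∧ Tendsto (fun j => f j x) atTop (𝓝 (g x))) →
    Monotone (fun j => ρ (f j)) ∧ Tendsto (fun j => ρ (f j)) atTop (𝓝 (ρ g))
  indicator_lt_top : ∀ A : Set (EuclideanSpace ℝ (Fin n)), Bornology.IsBounded A →
    NullMeasurableSet A volume → ρ (A.indicator 1) < ∞
  setLIntegral_le : ∀ A : Set (EuclideanSpace ℝ (Fin n)), Bornology.IsBounded A →
    NullMeasurableSet A volume →
    ∃ C : ℝ≥0, ∀ f, AEMeasurable f volume → ∫⁻ x in A, f x ≤ C * ρ f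

/-- `X`, with the norm `N`, is a Banach function space on `ℝⁿ`: for some metric function `ρ`, it
is the set of all Lebesgue measurable functions `f` with `N f = ρ(|f|)` finite. -/
def IsBanachFunctionSpace {n : ℕ} (X : Set (EuclideanSpace ℝ (Fin n) → ℝ))
    (N : (EuclideanSpace ℝ (Fin n) → ℝ) → ℝ≥0∞) : Prop :=
  ∃ ρ : (EuclideanSpace ℝ (Fin n) → ℝ≥0∞) → ℝ≥0∞, IsFunctionMetric ρ ∧
    X = {f | AEMeasurable f volume ∧ ρ (fun x => ‖f x‖ₑ) < ∞} ∧
    ∀ f, AEMeasurable f volume → N f = ρ (fun x => ‖f x‖ₑ)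

end

end RieszBFS

namespace RieszBFS

/-! The infimum over weights can be taken over `w = (I_α f) ^ r` with `f` in the nonnegative part of
the unit ball of `L^s`. Such a `w` is admissible, since `I_α` maps `L^s` to `L^s_loc` and `r ≤ s`.
Conversely, `w ^ (1 / r) ≤ I_α f` q.e. holds a.e., and passing to the larger weight lowers the
integral because `1 - q < 0` (`exists_of_nbarMetric_lt`, `nbarMetric_le`).

The triangle inequality combines two convexity facts. The perspective `x ^ q * u ^ (1 - q)` is
jointly convex, and the admissible weights are convex up to domination: `θ₁ (I_α f₁) ^ r + θ₂ (I_α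
f₂) ^ r` is at most `(I_α f) ^ r` with `f = (θ₁ f₁ ^ s + θ₂ f₂ ^ s) ^ (1 / s)`, by the power mean
inequality for `s / r ≥ 1` and `add_rieszPotential_rpow_le`. Bounded sets have finite norm because
the potential of a ball is bounded below on that ball. The local `L^1` bound is Hölder's inequality
against `(I_α f) ^ r`, whose integral over a ball is bounded uniformly in `f`; it also gives
definiteness.

The Fatou property needs one `f` that serves all `f_j`. For fixed `L`, the `f` in the nonnegative
unit ball whose energy against `f_j` is at most `L ^ q` form a decreasing sequence of sets: convex,
since `I_α` is linear and negative powers are convex, and closed, since the energy is lower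
semicontinuous. Uniform convexity of `L^s` gives a common point
(`nonempty_iInter_of_uniformly_convex`), and monotone convergence passes to the limit. -/

/-! ### Elementary convexity inequalities for powers. -/

/-- Joint convexity of the perspective function `(x, u) ↦ x ^ q * u ^ (1 - q)`. -/
theorem add_rpow_mul_add_rpow_le {q : ℝ} (hq : 1 < q) (x y u v : ℝ≥0∞) :
    (x + y) ^ q * (u + v) ^ (1 - q) ≤ x ^ q * u ^ (1 - q) + y ^ q * v ^ (1 - q) := by
  have hq0 : 0 < q := by linarith
  have hq1 : 1 - q < 0 := by linarith
  -- Degenerate denominators: a zero one under a nonzero numerator makes the right side infinite,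
  -- and an infinite one makes the left side zero.
  rcases eq_or_ne u 0 with rfl | hu0
  · rcases eq_or_ne x 0 with rfl | hx0
    · simp
    · simp [hq1, ENNReal.mul_top, hx0, hq0.not_gt]
  rcases eq_or_ne v 0 with rfl | hv0
  · rcases eq_or_ne y 0 with rfl | hy0
    · simp
    · simp [hq1, ENNReal.mul_top, hy0, hq0.not_gt]
  rcases eq_or_ne u ∞ with rfl | hu
  · simp [hq1]
  rcases eq_or_ne v ∞ with rfl | hv
  · simp [hq1]
  set W := u + v with hW
  have hW0 : W ≠ 0 := by simp [hW, hu0]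
  have hWt : W ≠ ∞ := by simp [hW, hu, hv]
  have key : ∀ z w : ℝ≥0∞, w ≠ 0 → w ≠ ∞ →
      w * W⁻¹ * (z * W * w⁻¹) ^ q * W ^ (1 - q) = z ^ q * w ^ (1 - q) := by
    intro z w hw0 hw
    have h1 : w * w⁻¹ ^ q = w ^ (1 - q) := by
      rw [ENNReal.inv_rpow, ← ENNReal.rpow_neg, sub_eq_add_neg,
        ENNReal.rpow_add _ _ hw0 hw, ENNReal.rpow_one]
    have h2 : W⁻¹ * W ^ q * W ^ (1 - q) = 1 := by
      rw [mul_assoc, ← ENNReal.rpow_add _ _ hW0 hWt]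
      simp [ENNReal.inv_mul_cancel hW0 hWt]
    calc w * W⁻¹ * (z * W * w⁻¹) ^ q * W ^ (1 - q)
        = z ^ q * (w * w⁻¹ ^ q) * (W⁻¹ * W ^ q * W ^ (1 - q)) := by
          rw [ENNReal.mul_rpow_of_nonneg _ _ hq0.le, ENNReal.mul_rpow_of_nonneg _ _ hq0.le]; ring
      _ = _ := by rw [h1, h2, mul_one]
  have key2 : ∀ z w : ℝ≥0∞, w ≠ 0 → w ≠ ∞ → w * W⁻¹ * (z * W * w⁻¹) = z := by
    intro z w hw0 hw
    calc _ = z * (w * w⁻¹) * (W * W⁻¹) := by ring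
      _ = z := by rw [ENNReal.mul_inv_cancel hw0 hw, ENNReal.mul_inv_cancel hW0 hWt]; simp
  -- Jensen for `t ^ q` with weights `u / W`, `v / W` at the points `x W / u`, `y W / v`, whose mean
  -- is `x + y`; multiplying by `W ^ (1 - q)` gives the claim.
  have h := ENNReal.rpow_arith_mean_le_arith_mean2_rpow (u * W⁻¹) (v * W⁻¹) (x * W * u⁻¹)
    (y * W * v⁻¹) (by rw [← add_mul, ENNReal.mul_inv_cancel hW0 hWt]) hq.le
  rw [key2 x u hu0 hu, key2 y v hv0 hv] at h
  rw [← key x u hu0 hu, ← key y v hv0 hv, ← add_mul]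
  gcongr

/-- Convexity of negative powers at midpoints. -/
theorem half_add_rpow_le {t : ℝ} (ht : t < 0) (X Y : ℝ≥0∞) :
    (2⁻¹ * X + 2⁻¹ * Y) ^ t ≤ 2⁻¹ * X ^ t + 2⁻¹ * Y ^ t := by
  -- The exponent `q = 1 - t` makes `1 - q = t`, and numerators `1/2` add up to `1`, so only the
  -- power `t` survives on the left.
  have h := add_rpow_mul_add_rpow_le (q := 1 - t) (by linarith) 2⁻¹ 2⁻¹ (2⁻¹ * X) (2⁻¹ * Y)
  have h2 : ∀ Z : ℝ≥0∞, (2⁻¹ : ℝ≥0∞) ^ (1 - t) * (2⁻¹ * Z) ^ (1 - (1 - t)) = 2⁻¹ * Z ^ t := by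
    intro Z
    have : (2⁻¹ : ℝ≥0∞) ^ (1 - t) * 2⁻¹ ^ t = 2⁻¹ := by
      rw [← ENNReal.rpow_add _ _ (by simp) (by simp)]; simp
    rcases eq_or_ne Z ∞ with rfl | hZ
    · simp [ht, ENNReal.mul_top]
    · rw [ENNReal.mul_rpow_of_ne_top (by simp) hZ, ← mul_assoc]
      simp [this]
  rw [h2, h2, ENNReal.inv_two_add_inv_two] at h
  simpa using h

/-- Uniform convexity of `x ↦ x ^ s` on nonnegative numbers, in homogeneous form. -/
theorem exists_abs_sub_rpow_le {s : ℝ} (hs : 1 < s) {ε : ℝ} (hε : 0 < ε) :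
    ∃ K : ℝ, 0 < K ∧ ∀ a b : ℝ, 0 ≤ a → 0 ≤ b →
      |a - b| ^ s + K * ((a + b) / 2) ^ s ≤ (ε + K / 2) * (a ^ s + b ^ s) := by
  have hs0 : 0 < s := by linarith
  set G : ℝ × ℝ → ℝ := fun x => (x.1 ^ s + x.2 ^ s) / 2 - ((x.1 + x.2) / 2) ^ s with hG
  have hGpos : ∀ a b : ℝ, 0 ≤ a → 0 ≤ b → a ≠ b → 0 < G (a, b) := by
    intro a b ha hb hab
    have := (strictConvexOn_rpow hs).2 (Set.mem_Ici.2 ha) (Set.mem_Ici.2 hb) hab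
      (one_half_pos (α := ℝ)) one_half_pos (add_halves 1)
    simp only [smul_eq_mul] at this
    rw [show (1 / 2 * a + 1 / 2 * b : ℝ) = (a + b) / 2 by ring] at this
    simp only [hG]; linarith
  have hGnn : ∀ a b : ℝ, 0 ≤ a → 0 ≤ b → 0 ≤ G (a, b) := by
    intro a b ha hb
    rcases eq_or_ne a b with rfl | h
    · simp [hG]
    · exact (hGpos a b ha hb h).le
  have hGc : Continuous G := by
    simp only [hG]
    refine Continuous.sub (Continuous.div_const (Continuous.add ?_ ?_) _) ?_ <;>
    exact Continuous.rpow_const (by fun_prop) (fun _ => Or.inr hs0.le)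
  have hNc : Continuous fun x : ℝ × ℝ => |x.1 - x.2| ^ s - ε * (x.1 ^ s + x.2 ^ s) := by
    refine Continuous.sub ?_ (Continuous.mul continuous_const (Continuous.add ?_ ?_)) <;>
    exact Continuous.rpow_const (by fun_prop) (fun _ => Or.inr hs0.le)
  -- By homogeneity it suffices to treat `a + b = 1`. On the part of this segment where `ε` alone
  -- does not suffice, the diagonal is excluded, so by compactness the Jensen gap `G` is at least
  -- some `m > 0`; as `|a - b| ≤ 1`, the constant `K = 1 / m` works.
  set S : Set (ℝ × ℝ) := (Set.Icc 0 1 ×ˢ Set.Icc 0 1) ∩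
    ({x | x.1 + x.2 = 1} ∩ {x | 0 ≤ |x.1 - x.2| ^ s - ε * (x.1 ^ s + x.2 ^ s)}) with hS
  have hSc : IsCompact S := by
    refine (isCompact_Icc.prod isCompact_Icc).inter_right (IsClosed.inter ?_ ?_)
    · exact isClosed_eq (by fun_prop) (by fun_prop)
    · exact isClosed_le continuous_const hNc
  have hm : ∃ m > 0, ∀ x ∈ S, m ≤ G x := by
    rcases S.eq_empty_or_nonempty with h | h
    · exact ⟨1, one_pos, by simp [h]⟩
    · obtain ⟨x, hx, hmin⟩ := hSc.exists_isMinOn h hGc.continuousOn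
      refine ⟨G x, ?_, fun y hy => hmin hy⟩
      obtain ⟨⟨⟨h1, -⟩, ⟨h2, -⟩⟩, h3, h4⟩ := hx
      refine hGpos _ _ h1 h2 fun h => ?_
      simp only [Set.mem_ofPred_eq] at h3 h4
      rw [h] at h4 h3
      have : 0 < x.2 := by linarith
      have : 0 < x.2 ^ s := Real.rpow_pos_of_pos this s
      rw [sub_self, abs_zero, Real.zero_rpow hs0.ne'] at h4
      nlinarith
  obtain ⟨m, hm0, hm⟩ := hm
  have hunit : ∀ a b : ℝ, 0 ≤ a → 0 ≤ b → a + b = 1 →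
      |a - b| ^ s ≤ ε * (a ^ s + b ^ s) + m⁻¹ * G (a, b) := by
    intro a b ha hb hab
    have := hGnn a b ha hb
    have hm' : 0 < m⁻¹ := by positivity
    by_cases hmem : (a, b) ∈ S
    · have h1 := hm _ hmem
      have h2 : |a - b| ^ s ≤ 1 := Real.rpow_le_one (abs_nonneg _)
        (abs_le.2 ⟨by linarith, by linarith⟩) hs0.le
      have h3 : 1 ≤ m⁻¹ * G (a, b) := by
        rw [inv_mul_eq_div, le_div_iff₀ hm0]; linarith
      have : 0 ≤ ε * (a ^ s + b ^ s) := by positivity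
      linarith
    · have : |a - b| ^ s - ε * (a ^ s + b ^ s) < 0 := by
        by_contra! h
        exact hmem ⟨⟨⟨ha, by simp; linarith⟩, ⟨hb, by simp; linarith⟩⟩, hab, h⟩
      have : 0 ≤ m⁻¹ * G (a, b) := by positivity
      linarith
  refine ⟨m⁻¹, by positivity, fun a b ha hb => ?_⟩
  rcases (add_nonneg ha hb).eq_or_lt with h0 | h0
  · have ha0 : a = 0 := by linarith
    have hb0 : b = 0 := by linarith
    simp [ha0, hb0, Real.zero_rpow hs0.ne']
  · have h := hunit (a / (a + b)) (b / (a + b)) (by positivity) (by positivity)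
      (by rw [← add_div, div_self h0.ne'])
    have hc : 0 < (a + b) ^ s := Real.rpow_pos_of_pos h0 s
    simp only [hG] at h
    rw [← sub_div, ← add_div, abs_div, abs_of_pos h0, Real.div_rpow (abs_nonneg _) h0.le,
      Real.div_rpow ha h0.le, Real.div_rpow hb h0.le,
      show (a + b) / (a + b) / 2 = ((a + b) / 2) / (a + b) by ring,
      Real.div_rpow (by positivity) h0.le, ← add_div, div_div, mul_comm ((a + b) ^ s) 2,
      ← div_div, ← sub_div, mul_div_assoc', mul_div_assoc', ← add_div,
      div_le_div_iff_of_pos_right hc] at h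
    linarith

/-! ### The Riesz kernel and the local `L^s` bound for Riesz potentials. -/

section kernel

variable {n : ℕ} {α s : ℝ}

theorem lintegral_ball_enorm_rpow_lt_top (hn : 1 ≤ n) {β : ℝ} (hβ : -n < β) (R : ℝ) :
    ∫⁻ x : EuclideanSpace ℝ (Fin n) in Metric.ball 0 R, ‖x‖ₑ ^ β < ∞ := by
  have : Nonempty (Fin n) := ⟨⟨0, hn⟩⟩
  have h := integrableOn_ball_of_norm_le_rpow (E := EuclideanSpace ℝ (Fin n)) (μ := volume)
    (f := fun x => ‖x‖ ^ β) (C := 1) (α := -β) (r := R) (by simpa using hn)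
    (by simp; linarith) (Eventually.of_forall fun x => by
      rw [neg_neg, one_mul, Real.norm_of_nonneg (by positivity)])
    (measurable_norm.pow_const β).aestronglyMeasurable
  refine lt_of_le_of_lt (le_of_eq ?_) h.2
  refine lintegral_congr_ae (ae_restrict_of_ae ?_)
  filter_upwards [Measure.ae_ne volume (0 : EuclideanSpace ℝ (Fin n))] with x hx
  rw [← ofReal_norm, ← ofReal_norm, Real.norm_of_nonneg (by positivity),
    ENNReal.ofReal_rpow_of_pos (norm_pos_iff.2 hx)]

theorem lintegral_compl_ball_enorm_rpow_lt_top {β : ℝ} (hβ : β < -n) :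
    ∫⁻ x : EuclideanSpace ℝ (Fin n) in (Metric.ball 0 1)ᶜ, ‖x‖ₑ ^ β < ∞ := by
  have h := finite_integral_one_add_norm (E := EuclideanSpace ℝ (Fin n)) (μ := volume) (r := -β)
    (by simp; linarith)
  have hn : (0 : ℝ) ≤ n := n.cast_nonneg
  calc ∫⁻ x : EuclideanSpace ℝ (Fin n) in (Metric.ball 0 1)ᶜ, ‖x‖ₑ ^ β
      ≤ ∫⁻ x : EuclideanSpace ℝ (Fin n) in (Metric.ball 0 1)ᶜ,
          ENNReal.ofReal (2 ^ (-β)) * ENNReal.ofReal ((1 + ‖x‖) ^ (- -β)) := by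
        refine setLIntegral_mono' Metric.isOpen_ball.measurableSet.compl fun x hx => ?_
        have hx1 : 1 ≤ ‖x‖ := by simpa using hx
        rw [← ofReal_norm, ENNReal.ofReal_rpow_of_pos (by linarith),
          ← ENNReal.ofReal_mul (by positivity), neg_neg]
        refine ENNReal.ofReal_le_ofReal ?_
        calc ‖x‖ ^ β ≤ ((1 + ‖x‖) / 2) ^ β :=
              Real.rpow_le_rpow_of_nonpos (by positivity) (by linarith) (by linarith)
          _ = _ := by
              rw [Real.div_rpow (by positivity) (by norm_num), Real.rpow_neg (by norm_num)]
              ring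
    _ ≤ ∫⁻ x : EuclideanSpace ℝ (Fin n),
          ENNReal.ofReal (2 ^ (-β)) * ENNReal.ofReal ((1 + ‖x‖) ^ (- -β)) :=
        setLIntegral_le_lintegral _ _
    _ < ∞ := by
        rw [lintegral_const_mul' _ _ ENNReal.ofReal_ne_top]
        exact ENNReal.mul_lt_top ENNReal.ofReal_lt_top h

/-- **Young's inequality** for the convolution with an integrable kernel. -/
theorem lintegral_lintegral_mul_rpow_le (hs : 1 < s)
    {k f : EuclideanSpace ℝ (Fin n) → ℝ≥0∞} (hk : Measurable k) (hf : Measurable f) :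
    ∫⁻ x, (∫⁻ y, k (x - y) * f y) ^ s ≤ (∫⁻ x, k x) ^ s * ∫⁻ x, f x ^ s := by
  have hs0 : 0 < s := by linarith
  have hpq : s.HolderConjugate (s / (s - 1)) := .conjExponent hs
  set q := s / (s - 1) with hq
  have hsq : 1 / q * s = s - 1 := by
    rw [hq, one_div_div]; field_simp
  have hsum : 1 / q + 1 / s = 1 := by
    rw [add_comm]; simpa using hpq.inv_add_inv_eq_one
  have hpt : ∀ x, (∫⁻ y, k (x - y) * f y) ^ s ≤
      (∫⁻ x, k x) ^ (s - 1) * ∫⁻ y, k (x - y) * f y ^ s := by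
    intro x
    -- Splitting `k = k ^ (1 / q) * k ^ (1 / s)` lets Hölder keep one factor of `k` next to `f ^ s`;
    -- Tonelli then integrates it out.
    have h := ENNReal.lintegral_mul_le_Lp_mul_Lq volume hpq.symm
      (f := fun y => k (x - y) ^ (1 / q)) (g := fun y => k (x - y) ^ (1 / s) * f y)
      (by fun_prop) (by fun_prop)
    have e1 : ∀ y, ((fun y => k (x - y) ^ (1 / q)) * fun y => k (x - y) ^ (1 / s) * f y) y
        = k (x - y) * f y := by
      intro y
      have h0 : 0 ≤ 1 / q := by have := hpq.symm.pos; positivity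
      simp only [Pi.mul_apply]
      rw [← mul_assoc, ← ENNReal.rpow_add_of_nonneg _ _ h0 (by positivity), hsum, ENNReal.rpow_one]
    have e2 : ∀ y, (k (x - y) ^ (1 / q)) ^ q = k (x - y) := fun y => by
      rw [← ENNReal.rpow_mul, one_div_mul_cancel hpq.symm.pos.ne', ENNReal.rpow_one]
    have e3 : ∀ y, (k (x - y) ^ (1 / s) * f y) ^ s = k (x - y) * f y ^ s := fun y => by
      rw [ENNReal.mul_rpow_of_nonneg _ _ hs0.le, ← ENNReal.rpow_mul, one_div_mul_cancel hs0.ne',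
        ENNReal.rpow_one]
    simp only [e1, e2, e3] at h
    rw [lintegral_sub_left_eq_self k x] at h
    calc _ ≤ _ := ENNReal.rpow_le_rpow h hs0.le
      _ = _ := by
        rw [ENNReal.mul_rpow_of_nonneg _ _ hs0.le, ← ENNReal.rpow_mul, ← ENNReal.rpow_mul, hsq,
          one_div_mul_cancel hs0.ne', ENNReal.rpow_one]
  have hm : Measurable fun z : EuclideanSpace ℝ (Fin n) × EuclideanSpace ℝ (Fin n) =>
      k (z.1 - z.2) * f z.2 ^ s := by fun_prop
  calc ∫⁻ x, (∫⁻ y, k (x - y) * f y) ^ s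
      ≤ ∫⁻ x, (∫⁻ x, k x) ^ (s - 1) * ∫⁻ y, k (x - y) * f y ^ s := lintegral_mono hpt
    _ = (∫⁻ x, k x) ^ (s - 1) * ∫⁻ x, ∫⁻ y, k (x - y) * f y ^ s :=
        lintegral_const_mul _ hm.lintegral_prod_right'
    _ = (∫⁻ x, k x) ^ (s - 1) * ∫⁻ y, (∫⁻ x, k x) * f y ^ s := by
        rw [lintegral_lintegral_swap hm.aemeasurable]
        congr 1
        refine lintegral_congr fun y => ?_
        rw [lintegral_mul_const _ (by fun_prop), lintegral_sub_right_eq_self k y]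
    _ = _ := by
        rw [lintegral_const_mul _ (by fun_prop), ← mul_assoc]
        congr 1
        nth_rw 2 [← ENNReal.rpow_one (∫⁻ x, k x)]
        rw [← ENNReal.rpow_add_of_nonneg _ _ (by linarith) zero_le_one, sub_add_cancel]

/-- **Hölder's inequality** for a convolution. -/
theorem lintegral_mul_rpow_le (hs : 1 < s)
    {k f : EuclideanSpace ℝ (Fin n) → ℝ≥0∞} (hk : Measurable k) (hf : Measurable f)
    (x : EuclideanSpace ℝ (Fin n)) :
    (∫⁻ y, k (x - y) * f y) ^ s ≤
      (∫⁻ x, k x ^ (s / (s - 1))) ^ (s - 1) * ∫⁻ x, f x ^ s := by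
  have hs0 : 0 < s := by linarith
  have hpq : s.HolderConjugate (s / (s - 1)) := .conjExponent hs
  set q := s / (s - 1) with hq
  have hsq : 1 / q * s = s - 1 := by
    rw [hq, one_div_div]; field_simp
  have h := ENNReal.lintegral_mul_le_Lp_mul_Lq volume hpq.symm
    (f := fun y => k (x - y)) (g := f) (by fun_prop) (by fun_prop)
  rw [lintegral_sub_left_eq_self (fun y => k y ^ q) x] at h
  calc _ ≤ _ := ENNReal.rpow_le_rpow h hs0.le
    _ = _ := by
      rw [ENNReal.mul_rpow_of_nonneg _ _ hs0.le, ← ENNReal.rpow_mul, ← ENNReal.rpow_mul, hsq,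
        one_div_mul_cancel hs0.ne', ENNReal.rpow_one]

theorem rieszPotential_congr_ae {f g : EuclideanSpace ℝ (Fin n) → ℝ≥0∞} (h : f =ᵐ[volume] g)
    (x : EuclideanSpace ℝ (Fin n)) : rieszPotential α f x = rieszPotential α g x := by
  unfold rieszPotential
  congr 1
  refine lintegral_congr_ae ?_
  filter_upwards [h] with y hy
  rw [hy]

theorem rieszPotential_mono_ae {f g : EuclideanSpace ℝ (Fin n) → ℝ≥0∞} (h : f ≤ᵐ[volume] g)
    (x : EuclideanSpace ℝ (Fin n)) : rieszPotential α f x ≤ rieszPotential α g x := by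
  unfold rieszPotential
  refine mul_le_mul' le_rfl ?_
  refine lintegral_mono_ae ?_
  filter_upwards [h] with y hy
  gcongr

theorem rieszPotential_const_mul {f : EuclideanSpace ℝ (Fin n) → ℝ≥0∞}
    (hf : AEMeasurable f volume) (c : ℝ≥0∞) (x : EuclideanSpace ℝ (Fin n)) :
    rieszPotential α (fun y => c * f y) x = c * rieszPotential α f x := by
  unfold rieszPotential
  simp_rw [mul_left_comm _ c]
  rw [lintegral_const_mul'' _ (by fun_prop), mul_left_comm]

theorem rieszPotential_add {f g : EuclideanSpace ℝ (Fin n) → ℝ≥0∞}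
    (hf : AEMeasurable f volume) (x : EuclideanSpace ℝ (Fin n)) :
    rieszPotential α (fun y => f y + g y) x =
      rieszPotential α f x + rieszPotential α g x := by
  unfold rieszPotential
  simp_rw [mul_add]
  rw [lintegral_add_left' (by fun_prop), mul_add]

theorem rieszPotential_tsum {f : ℕ → EuclideanSpace ℝ (Fin n) → ℝ≥0∞}
    (hf : ∀ j, AEMeasurable (f j) volume) (x : EuclideanSpace ℝ (Fin n)) :
    rieszPotential α (fun y => ∑' j, f j y) x = ∑' j, rieszPotential α (f j) x := by
  unfold rieszPotential
  simp_rw [← ENNReal.tsum_mul_left]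
  rw [lintegral_tsum (fun j => by have := hf j; fun_prop), ENNReal.tsum_mul_left]

theorem measurable_rieszPotential {f : EuclideanSpace ℝ (Fin n) → ℝ≥0∞}
    (hf : AEMeasurable f volume) : Measurable (rieszPotential α f) := by
  have h : rieszPotential α f = rieszPotential α (hf.mk f) :=
    funext (rieszPotential_congr_ae hf.ae_eq_mk)
  have hm := hf.measurable_mk
  rw [h]
  unfold rieszPotential
  refine Measurable.const_mul (Measurable.lintegral_prod_right' (f := fun z :
    EuclideanSpace ℝ (Fin n) × EuclideanSpace ℝ (Fin n) => ‖z.1 - z.2‖ₑ ^ (α - n) * hf.mk f z.2)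
    ?_) _
  fun_prop

/-- The Riesz potential maps `L^s` continuously to `L^s_loc` if `0 < α < n / s`. -/
theorem exists_setLIntegral_rieszPotential_rpow_le (hs : 1 < s) (hα : 0 < α) (hαs : α < n / s)
    (R : ℝ) : ∃ C : ℝ≥0, ∀ f : EuclideanSpace ℝ (Fin n) → ℝ≥0∞, AEMeasurable f volume →
      ∫⁻ x in Metric.ball 0 R, rieszPotential α f x ^ s ≤ C * ∫⁻ x, f x ^ s := by
  have hs0 : 0 < s := by linarith
  have hαs' : α * s < n := by rwa [lt_div_iff₀ hs0] at hαs
  have hn : 1 ≤ n := by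
    rcases Nat.eq_zero_or_pos n with rfl | h
    · simp at hαs; linarith
    · exact h
  set k : EuclideanSpace ℝ (Fin n) → ℝ≥0∞ := fun x => ‖x‖ₑ ^ (α - n) with hk
  have hkm : Measurable k := by fun_prop
  -- The kernel is cut at the unit sphere. The near part is integrable because `α > 0`, and Young
  -- applies; the far part lies in `L^{s'}` exactly because `α s < n`, and Hölder bounds its
  -- convolution uniformly, hence in `L^s` of a ball.
  set B : Set (EuclideanSpace ℝ (Fin n)) := Metric.ball 0 1 with hB
  have hBm : MeasurableSet B := Metric.isOpen_ball.measurableSet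
  have hk1 : ∫⁻ x, B.indicator k x < ∞ := by
    rw [lintegral_indicator hBm]
    exact lintegral_ball_enorm_rpow_lt_top hn (by linarith) 1
  have hk2 : ∫⁻ x, Bᶜ.indicator k x ^ (s / (s - 1)) < ∞ := by
    have h0 : 0 < s / (s - 1) := div_pos hs0 (by linarith)
    have : ∀ x, Bᶜ.indicator k x ^ (s / (s - 1)) =
        Bᶜ.indicator (fun x => ‖x‖ₑ ^ ((α - n) * (s / (s - 1)))) x := by
      intro x
      by_cases hx : x ∈ B <;> simp [hx, h0, hk, ENNReal.rpow_mul]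
    simp_rw [this]
    rw [lintegral_indicator hBm.compl]
    refine lintegral_compl_ball_enorm_rpow_lt_top ?_
    rw [mul_div_assoc', div_lt_iff₀ (by linarith)]
    nlinarith
  set κ₁ := ∫⁻ x, B.indicator k x with hκ₁
  set κ₂ := ∫⁻ x, Bᶜ.indicator k x ^ (s / (s - 1)) with hκ₂
  set V := volume (Metric.ball (0 : EuclideanSpace ℝ (Fin n)) R) with hV
  set C : ℝ≥0∞ := ENNReal.ofReal (rieszConst n α) ^ s *
    (2 ^ (s - 1) * (κ₁ ^ s + V * κ₂ ^ (s - 1))) with hC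
  have hCt : C ≠ ∞ := by
    refine ENNReal.mul_ne_top (ENNReal.rpow_ne_top_of_nonneg hs0.le ENNReal.ofReal_ne_top)
      (ENNReal.mul_ne_top (ENNReal.rpow_ne_top_of_nonneg (by linarith) (by simp))
        (ENNReal.add_ne_top.2 ⟨ENNReal.rpow_ne_top_of_nonneg hs0.le hk1.ne,
          ENNReal.mul_ne_top Metric.isBounded_ball.measure_lt_top.ne
            (ENNReal.rpow_ne_top_of_nonneg (by linarith) hk2.ne)⟩))
  have key : ∀ f : EuclideanSpace ℝ (Fin n) → ℝ≥0∞, Measurable f →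
      ∫⁻ x in Metric.ball 0 R, rieszPotential α f x ^ s ≤ C * ∫⁻ x, f x ^ s := by
    intro f hf
    have hsplit : ∀ x, ∫⁻ y, ‖x - y‖ₑ ^ (α - n) * f y =
        (∫⁻ y, B.indicator k (x - y) * f y) + ∫⁻ y, Bᶜ.indicator k (x - y) * f y := by
      intro x
      rw [← lintegral_add_left]
      · refine lintegral_congr fun y => ?_
        rw [← add_mul, Set.indicator_self_add_compl_apply]
      · have := hkm.indicator hBm
        fun_prop
    have hpt : ∀ x, rieszPotential α f x ^ s ≤ ENNReal.ofReal (rieszConst n α) ^ s *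
        (2 ^ (s - 1) * ((∫⁻ y, B.indicator k (x - y) * f y) ^ s +
          κ₂ ^ (s - 1) * ∫⁻ x, f x ^ s)) := by
      intro x
      rw [rieszPotential, hsplit, ENNReal.mul_rpow_of_nonneg _ _ hs0.le]
      gcongr
      refine (ENNReal.rpow_add_le_mul_rpow_add_rpow _ _ hs.le).trans ?_
      gcongr
      exact lintegral_mul_rpow_le hs (hkm.indicator hBm.compl) hf x
    have hγ : ENNReal.ofReal (rieszConst n α) ^ s ≠ ∞ :=
      ENNReal.rpow_ne_top_of_nonneg hs0.le ENNReal.ofReal_ne_top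
    have h2 : (2 : ℝ≥0∞) ^ (s - 1) ≠ ∞ := ENNReal.rpow_ne_top_of_nonneg (by linarith) (by simp)
    calc _ ≤ _ := lintegral_mono hpt
      _ = ENNReal.ofReal (rieszConst n α) ^ s * (2 ^ (s - 1) *
          ((∫⁻ x in Metric.ball 0 R, (∫⁻ y, B.indicator k (x - y) * f y) ^ s) +
            V * (κ₂ ^ (s - 1) * ∫⁻ x, f x ^ s))) := by
          rw [lintegral_const_mul' _ _ hγ, lintegral_const_mul' _ _ h2,
            lintegral_add_right _ measurable_const, setLIntegral_const, mul_comm V]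
      _ ≤ ENNReal.ofReal (rieszConst n α) ^ s * (2 ^ (s - 1) *
          (κ₁ ^ s * (∫⁻ x, f x ^ s) + V * (κ₂ ^ (s - 1) * ∫⁻ x, f x ^ s))) := by
          gcongr
          exact (setLIntegral_le_lintegral _ _).trans
            (lintegral_lintegral_mul_rpow_le hs (hkm.indicator hBm) hf)
      _ = _ := by rw [hC]; ring
  refine ⟨C.toNNReal, fun f hf => ?_⟩
  rw [ENNReal.coe_toNNReal hCt]
  have h1 : ∫⁻ x, f x ^ s = ∫⁻ x, hf.mk f x ^ s :=
    lintegral_congr_ae (by filter_upwards [hf.ae_eq_mk] with x hx; rw [hx])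
  simp_rw [rieszPotential_congr_ae hf.ae_eq_mk]
  rw [h1]
  exact key _ hf.measurable_mk

end kernel

/-! ### Finiteness, null sets, lower bounds and Minkowski's inequality for potentials. -/

section potential

variable {n : ℕ} {α s r : ℝ}

theorem ennreal_rpow_le_rpow_of_nonpos {z : ℝ} (hz : z ≤ 0) {x y : ℝ≥0∞} (h : x ≤ y) :
    y ^ z ≤ x ^ z := by
  rw [← neg_neg z, ENNReal.rpow_neg y, ENNReal.rpow_neg x]
  exact ENNReal.inv_le_inv.2 (ENNReal.rpow_le_rpow h (by linarith))

theorem rpow_le_one_add_rpow (hr : 0 < r) (hrs : r ≤ s) (x : ℝ≥0∞) : x ^ r ≤ 1 + x ^ s := by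
  rcases le_total x 1 with h | h
  · exact (ENNReal.rpow_le_one h hr.le).trans le_self_add
  · exact (ENNReal.rpow_le_rpow_of_exponent_le h hrs).trans le_add_self

/-- The point is that the constant is uniform over the unit ball of `L^s`: this gives both the local
integrability of the weights and the local `L^1` bound for the norm. -/
theorem exists_setLIntegral_rieszPotential_rpow_le_of_le (hs : 1 < s) (hα : 0 < α)
    (hαs : α < n / s) (hr : 0 < r) (hrs : r ≤ s) (R : ℝ) :
    ∃ C : ℝ≥0, ∀ f : EuclideanSpace ℝ (Fin n) → ℝ≥0∞, AEMeasurable f volume →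
      ∫⁻ x, f x ^ s ≤ 1 → ∫⁻ x in Metric.ball 0 R, rieszPotential α f x ^ r ≤ C := by
  obtain ⟨C, hC⟩ := exists_setLIntegral_rieszPotential_rpow_le (n := n) hs hα hαs R
  have hV : volume (Metric.ball (0 : EuclideanSpace ℝ (Fin n)) R) ≠ ∞ :=
    Metric.isBounded_ball.measure_lt_top.ne
  refine ⟨(volume (Metric.ball (0 : EuclideanSpace ℝ (Fin n)) R)).toNNReal + C,
    fun f hf hf1 => ?_⟩
  calc _ ≤ ∫⁻ x in Metric.ball 0 R, (1 + rieszPotential α f x ^ s) :=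
        lintegral_mono fun x => rpow_le_one_add_rpow hr hrs _
    _ = volume (Metric.ball (0 : EuclideanSpace ℝ (Fin n)) R) +
          ∫⁻ x in Metric.ball 0 R, rieszPotential α f x ^ s := by
        rw [lintegral_add_left measurable_const]; simp
    _ ≤ _ := by
        push_cast
        rw [ENNReal.coe_toNNReal hV]
        gcongr
        calc _ ≤ C * ∫⁻ x, f x ^ s := hC f hf
          _ ≤ C * 1 := by gcongr
          _ = C := mul_one _

theorem ae_of_forall_restrict_ball {P : EuclideanSpace ℝ (Fin n) → Prop}
    (h : ∀ R : ℕ, ∀ᵐ x ∂(volume.restrict (Metric.ball 0 (R : ℝ))), P x) : ∀ᵐ x, P x := by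
  rw [← Measure.restrict_univ (μ := (volume : Measure (EuclideanSpace ℝ (Fin n)))),
    ← Metric.iUnion_ball_nat (0 : EuclideanSpace ℝ (Fin n)), ae_restrict_iUnion_iff]
  exact h

theorem rieszPotential_ae_lt_top (hs : 1 < s) (hα : 0 < α) (hαs : α < n / s)
    {f : EuclideanSpace ℝ (Fin n) → ℝ≥0∞} (hf : AEMeasurable f volume)
    (hfs : ∫⁻ x, f x ^ s ≠ ∞) : ∀ᵐ x, rieszPotential α f x < ∞ := by
  refine ae_of_forall_restrict_ball fun R => ?_
  obtain ⟨C, hC⟩ := exists_setLIntegral_rieszPotential_rpow_le (n := n) hs hα hαs R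
  have h := ae_lt_top ((measurable_rieszPotential (α := α) hf).pow_const s)
    ((hC f hf).trans_lt (ENNReal.mul_lt_top ENNReal.coe_lt_top hfs.lt_top)).ne
  filter_upwards [h] with x hx
  exact (ENNReal.rpow_lt_top_iff_of_pos (by linarith)).1 hx

theorem locallyIntegrable_rieszPotential_rpow (hs : 1 < s) (hα : 0 < α) (hαs : α < n / s)
    (hr : 0 < r) (hrs : r ≤ s) {f : EuclideanSpace ℝ (Fin n) → ℝ≥0∞}
    (hf : AEMeasurable f volume) (hfs : ∫⁻ x, f x ^ s ≤ 1) :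
    LocallyIntegrable (fun x => rieszPotential α f x ^ r) volume := by
  intro x
  refine ⟨Metric.ball 0 (‖x‖ + 1), Metric.isOpen_ball.mem_nhds (by simp), ?_⟩
  obtain ⟨C, hC⟩ := exists_setLIntegral_rieszPotential_rpow_le_of_le (n := n) hs hα hαs hr hrs
    (‖x‖ + 1)
  refine ⟨((measurable_rieszPotential hf).pow_const r).aestronglyMeasurable, ?_⟩
  simpa [HasFiniteIntegral] using (hC f hf hfs).trans_lt ENNReal.coe_lt_top

/-- Chebyshev's inequality for `{I_α f ≥ 1}` on a ball, together with the local `L^s` bound,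
controls the measure by a multiple of the capacity. It turns q.e. inequalities into a.e. ones. -/
theorem measure_eq_zero_of_rieszCap_eq_zero (hs : 1 < s) (hα : 0 < α) (hαs : α < n / s)
    {A : Set (EuclideanSpace ℝ (Fin n))} (hA : rieszCap α s A = 0) : volume A = 0 := by
  have hs0 : 0 < s := by linarith
  have hA' : A = ⋃ R : ℕ, A ∩ Metric.ball 0 (R : ℝ) := by
    rw [← Set.inter_iUnion, Metric.iUnion_ball_nat, Set.inter_univ]
  rw [hA']
  refine measure_iUnion_null fun R => ?_
  obtain ⟨C, hC⟩ := exists_setLIntegral_rieszPotential_rpow_le (n := n) hs hα hαs R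
  have key : ∀ ε : ℝ≥0∞, 0 < ε → volume (A ∩ Metric.ball 0 (R : ℝ)) ≤ C * ε := by
    intro ε hε
    have : rieszCap α s A < ε := hA ▸ hε
    simp only [rieszCap, iInf_lt_iff] at this
    obtain ⟨f, hf, hfA, hfε⟩ := this
    have hm : MeasurableSet {x | 1 ≤ rieszPotential α f x} :=
      measurableSet_le measurable_const (measurable_rieszPotential hf)
    calc volume (A ∩ Metric.ball 0 (R : ℝ))
        ≤ volume ({x | 1 ≤ rieszPotential α f x} ∩ Metric.ball 0 (R : ℝ)) :=
          measure_mono (Set.inter_subset_inter_left _ hfA)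
      _ = ∫⁻ x in Metric.ball 0 (R : ℝ), {x | 1 ≤ rieszPotential α f x}.indicator 1 x := by
          rw [lintegral_indicator_one hm, Measure.restrict_apply hm]
      _ ≤ ∫⁻ x in Metric.ball 0 (R : ℝ), rieszPotential α f x ^ s := by
          refine lintegral_mono fun x => ?_
          by_cases hx : 1 ≤ rieszPotential α f x
          · simpa [hx] using ENNReal.one_le_rpow hx hs0
          · simp [hx]
      _ ≤ C * ∫⁻ x, f x ^ s := hC f hf
      _ ≤ C * ε := by gcongr
  refine le_antisymm (ge_of_tendsto' (f := fun j : ℕ => (C : ℝ≥0∞) * ((j : ℝ≥0∞))⁻¹)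
    (x := atTop) ?_ fun j => key _ (by simp)) bot_le
  have := ENNReal.Tendsto.const_mul (a := (C : ℝ≥0∞)) ENNReal.tendsto_inv_nat_nhds_zero
    (Or.inr ENNReal.coe_ne_top)
  simpa using this

theorem rieszConst_pos (hα : 0 < α) (hαn : α < n) : 0 < rieszConst n α := by
  unfold rieszConst
  have h1 := Real.Gamma_pos_of_pos (show 0 < (n - α) / 2 by linarith)
  have h2 := Real.Gamma_pos_of_pos (show 0 < α / 2 by linarith)
  positivity

/-- The potential of the indicator of a ball is bounded below on this ball. -/
theorem exists_le_rieszPotential_ball (hα : 0 < α) (hαn : α < n) {R : ℝ} (hR : 0 < R) :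
    ∃ c : ℝ≥0∞, 0 < c ∧ ∀ x ∈ Metric.ball (0 : EuclideanSpace ℝ (Fin n)) R,
      c ≤ rieszPotential α ((Metric.ball 0 R).indicator 1) x := by
  have hn : 1 ≤ n := by
    rcases Nat.eq_zero_or_pos n with rfl | h
    · simp at hαn; linarith
    · exact h
  have : Nonempty (Fin n) := ⟨⟨0, hn⟩⟩
  refine ⟨ENNReal.ofReal (rieszConst n α) * (ENNReal.ofReal (2 * R) ^ (α - n) *
    volume (Metric.ball (0 : EuclideanSpace ℝ (Fin n)) R)), ?_, fun x hx => ?_⟩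
  · have h1 := rieszConst_pos hα hαn
    have h2 := Metric.measure_ball_pos volume (0 : EuclideanSpace ℝ (Fin n)) hR
    refine ENNReal.mul_pos (by simpa using h1) (mul_ne_zero ?_ h2.ne')
    exact (ENNReal.rpow_pos (by simpa using hR) ENNReal.ofReal_ne_top).ne'
  · unfold rieszPotential
    gcongr
    rw [← setLIntegral_const]
    calc _ ≤ ∫⁻ y in Metric.ball 0 R, ‖x - y‖ₑ ^ (α - n) := by
          refine setLIntegral_mono' Metric.isOpen_ball.measurableSet fun y hy => ?_
          refine ennreal_rpow_le_rpow_of_nonpos (by linarith) ?_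
          rw [← ofReal_norm]
          refine ENNReal.ofReal_le_ofReal ((norm_sub_le _ _).trans ?_)
          simp only [Metric.mem_ball, dist_zero_right] at hx hy
          linarith
      _ = _ := by
          rw [← lintegral_indicator Metric.isOpen_ball.measurableSet]
          refine lintegral_congr fun y => ?_
          by_cases hy : y ∈ Metric.ball (0 : EuclideanSpace ℝ (Fin n)) R
          · simp only [Set.indicator_of_mem hy, Pi.one_apply, mul_one]
          · simp only [Set.indicator_of_notMem hy, mul_zero]

/-- **Minkowski's inequality** for the Riesz potential, with values in weighted `ℓ^s_2`. -/
theorem add_rieszPotential_rpow_le (hs : 1 < s) {f g : EuclideanSpace ℝ (Fin n) → ℝ≥0∞}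
    (hf : AEMeasurable f volume) (hg : AEMeasurable g volume) {a b : ℝ≥0∞}
    (ha : a ≠ ∞) (hb : b ≠ ∞) {x : EuclideanSpace ℝ (Fin n)}
    (hfx : rieszPotential α f x ≠ ∞) (hgx : rieszPotential α g x ≠ ∞) :
    (a * rieszPotential α f x ^ s + b * rieszPotential α g x ^ s) ^ (1 / s) ≤
      rieszPotential α (fun y => (a * f y ^ s + b * g y ^ s) ^ (1 / s)) x := by
  have hs0 : 0 < s := by linarith
  have hpq : s.HolderConjugate (s / (s - 1)) := .conjExponent hs
  set q := s / (s - 1) with hq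
  set X := rieszPotential α f x with hX
  set Y := rieszPotential α g x with hY
  set h := rieszPotential α (fun y => (a * f y ^ s + b * g y ^ s) ^ (1 / s)) x with hh
  set Z := a * X ^ s + b * Y ^ s with hZ
  have hZt : Z ≠ ∞ := ENNReal.add_ne_top.2
    ⟨ENNReal.mul_ne_top ha (ENNReal.rpow_ne_top_of_nonneg hs0.le hfx),
      ENNReal.mul_ne_top hb (ENNReal.rpow_ne_top_of_nonneg hs0.le hgx)⟩
  have hsplit : ∀ c u v : ℝ≥0∞, c * u ^ (s - 1) * v =
      (c ^ (1 / q) * u ^ (s - 1)) * (c ^ (1 / s) * v) := by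
    intro c u v
    have h1 : 1 / q + 1 / s = 1 := by rw [add_comm]; simpa using hpq.inv_add_inv_eq_one
    have h0 : 0 ≤ 1 / q := by have := hpq.symm.pos; positivity
    have : c ^ (1 / q) * c ^ (1 / s) = c := by
      rw [← ENNReal.rpow_add_of_nonneg _ _ h0 (by positivity), h1, ENNReal.rpow_one]
    calc _ = (c ^ (1 / q) * c ^ (1 / s)) * u ^ (s - 1) * v := by rw [this]
      _ = _ := by ring
  have hq1 : ∀ c u : ℝ≥0∞, (c ^ (1 / q) * u ^ (s - 1)) ^ q = c * u ^ s := by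
    intro c u
    rw [ENNReal.mul_rpow_of_nonneg _ _ hpq.symm.pos.le, ← ENNReal.rpow_mul, ← ENNReal.rpow_mul,
      one_div_mul_cancel hpq.symm.pos.ne', ENNReal.rpow_one, hq,
      mul_div_cancel₀ _ (by linarith : s - 1 ≠ 0)]
  have hs1 : ∀ c v : ℝ≥0∞, (c ^ (1 / s) * v) ^ s = c * v ^ s := by
    intro c v
    rw [ENNReal.mul_rpow_of_nonneg _ _ hs0.le, ← ENNReal.rpow_mul,
      one_div_mul_cancel hs0.ne', ENNReal.rpow_one]
  have hpt : ∀ u v : ℝ≥0∞, a * X ^ (s - 1) * u + b * Y ^ (s - 1) * v ≤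
      Z ^ (1 / q) * (a * u ^ s + b * v ^ s) ^ (1 / s) := by
    intro u v
    have := ENNReal.inner_le_Lp_mul_Lq (Finset.univ)
      ![a ^ (1 / q) * X ^ (s - 1), b ^ (1 / q) * Y ^ (s - 1)] ![a ^ (1 / s) * u, b ^ (1 / s) * v]
      hpq.symm
    simp only [Fin.sum_univ_two, Matrix.cons_val_zero, Matrix.cons_val_one, hq1, hs1] at this
    rwa [hsplit, hsplit b]
  -- Duality with the extremal vector: `Z` is the potential at `x` of `a X ^ (s - 1) f + b Y ^ (s -
  -- 1) g`, and two-term Hölder bounds this integrand pointwise. The finiteness of `Z` allows the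
  -- division by `Z ^ (1 / q)` below.
  have hle : Z ≤ Z ^ (1 / q) * h := by
    have h1 : ∀ u : ℝ≥0∞, u ^ (s - 1) * u = u ^ s := by
      intro u
      nth_rw 2 [← ENNReal.rpow_one u]
      rw [← ENNReal.rpow_add_of_nonneg _ _ (by linarith) zero_le_one, sub_add_cancel]
    calc Z = a * X ^ (s - 1) * X + b * Y ^ (s - 1) * Y := by
          rw [mul_assoc, mul_assoc, h1, h1]
      _ = rieszPotential α (fun y => a * X ^ (s - 1) * f y + b * Y ^ (s - 1) * g y) x := by
          rw [rieszPotential_add (by fun_prop), rieszPotential_const_mul hf,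
            rieszPotential_const_mul hg]
      _ ≤ rieszPotential α (fun y => Z ^ (1 / q) * (a * f y ^ s + b * g y ^ s) ^ (1 / s)) x :=
          rieszPotential_mono_ae (Eventually.of_forall fun y => hpt _ _) x
      _ = _ := rieszPotential_const_mul (by fun_prop) _ x
  rcases eq_or_ne Z 0 with hZ0 | hZ0
  · rw [hZ0, ENNReal.zero_rpow_of_pos (by positivity)]; exact bot_le
  · have e : Z = Z ^ (1 / q) * Z ^ (1 / s) := by
      rw [← ENNReal.rpow_add _ _ hZ0 hZt, show 1 / q + 1 / s = 1 by
        rw [add_comm]; simpa using hpq.inv_add_inv_eq_one, ENNReal.rpow_one]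
    nth_rw 1 [e] at hle
    have h0 : Z ^ (1 / q) ≠ 0 := (ENNReal.rpow_pos (pos_iff_ne_zero.2 hZ0) hZt).ne'
    have h2 : Z ^ (1 / q) ≠ ∞ := ENNReal.rpow_ne_top_of_nonneg
      (by have := hpq.symm.pos; positivity) hZt
    exact (ENNReal.mul_le_mul_iff_right h0 h2).1 hle

end potential

/-! ### The functional through potential weights, and all its properties except Fatou. -/

section metric

variable {n : ℕ} {α s r q : ℝ}

/-- The function `f` itself is a competitor, with empty exceptional set. -/
theorem fNorm_rieszPotential_rpow_le_one (hs : 1 < s) (hr : 0 < r)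
    {f : EuclideanSpace ℝ (Fin n) → ℝ≥0∞} (hf : AEMeasurable f volume)
    (hfs : ∫⁻ x, f x ^ s ≤ 1) : fNorm α s r (fun x => rieszPotential α f x ^ r) ≤ 1 := by
  have hs0 : 0 < s := by linarith
  refine iInf_le_of_le f (iInf_le_of_le hf (iInf_le_of_le ?_
    (ENNReal.rpow_le_one hfs (by positivity))))
  have : {x | ¬ (rieszPotential α f x ^ r) ^ (1 / r) ≤ rieszPotential α f x} = ∅ := by
    ext x
    simp [← ENNReal.rpow_mul, mul_inv_cancel₀ hr.ne']
  unfold QuasiEverywhere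
  rw [this]
  refine le_antisymm ?_ bot_le
  refine iInf_le_of_le 0 (iInf_le_of_le aemeasurable_const (iInf_le_of_le (by simp) ?_))
  simp [hs0]

theorem nbarMetric_le (hs : 1 < s) (hα : 0 < α) (hαs : α < n / s) (hr : 0 < r) (hrs : r ≤ s)
    {f g : EuclideanSpace ℝ (Fin n) → ℝ≥0∞} (hf : AEMeasurable f volume)
    (hfs : ∫⁻ x, f x ^ s ≤ 1) :
    nbarMetric α s r q g ≤ (∫⁻ x, g x ^ q * rieszPotential α f x ^ (r * (1 - q))) ^ (1 / q) := by
  simp_rw [ENNReal.rpow_mul]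
  exact iInf_le_of_le _ (iInf_le_of_le
    (locallyIntegrable_rieszPotential_rpow hs hα hαs hr hrs hf hfs)
    (iInf_le _ (fNorm_rieszPotential_rpow_le_one hs hr hf hfs)))

/-- It suffices to consider the weights `(I_α f) ^ r` with `‖f‖_{L^s} ≤ 1`. -/
theorem exists_of_nbarMetric_lt (hs : 1 < s) (hα : 0 < α) (hαs : α < n / s) (hr : 0 < r)
    (hq : 1 < q) {g : EuclideanSpace ℝ (Fin n) → ℝ≥0∞} {L : ℝ≥0∞}
    (hL : nbarMetric α s r q g < L) :
    ∃ f : EuclideanSpace ℝ (Fin n) → ℝ≥0∞, AEMeasurable f volume ∧ ∫⁻ x, f x ^ s ≤ 1 ∧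
      (∫⁻ x, g x ^ q * rieszPotential α f x ^ (r * (1 - q))) ^ (1 / q) < L := by
  have hs0 : 0 < s := by linarith
  have hq0 : 0 < q := by linarith
  simp only [nbarMetric, iInf_lt_iff] at hL
  obtain ⟨w, -, hw1, hwL⟩ := hL
  set v := ∫⁻ x, g x ^ q * w x ^ (1 - q) with hv
  have hvt : v ≠ ∞ := fun h => by
    rw [h, ENNReal.top_rpow_of_pos (by positivity)] at hwL
    exact not_top_lt hwL
  -- The infimum defining `fNorm` need not be attained, so `f` is only found with `‖f‖ ^ r < c` for
  -- `c > 1`. Rescaling it into the unit ball costs the factor `c ^ (q - 1)`, which the strict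
  -- inequality absorbs for `c` near `1`.
  obtain ⟨c, hc1, hct, hcL⟩ : ∃ c : ℝ≥0∞, 1 < c ∧ c < ∞ ∧ (c ^ (q - 1) * v) ^ (1 / q) < L := by
    have hcont : Tendsto (fun c : ℝ≥0∞ => (c ^ (q - 1) * v) ^ (1 / q)) (𝓝 1)
        (𝓝 (v ^ (1 / q))) := by
      have h1 : Tendsto (fun c : ℝ≥0∞ => c ^ (q - 1)) (𝓝 1) (𝓝 1) := by
        simpa using (ENNReal.continuous_rpow_const (y := q - 1)).tendsto 1
      have h2 := ENNReal.Tendsto.mul_const h1 (b := v) (Or.inr hvt)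
      rw [one_mul] at h2
      exact ((ENNReal.continuous_rpow_const (y := 1 / q)).tendsto v).comp h2
    have h3 := (hcont.eventually (gt_mem_nhds hwL)).and (gt_mem_nhds ENNReal.one_lt_top)
    obtain ⟨c, hc, hc'⟩ := ((h3.filter_mono nhdsWithin_le_nhds).and
      (self_mem_nhdsWithin (s := Set.Ioi (1 : ℝ≥0∞)))).exists
    exact ⟨c, hc', hc.2, hc.1⟩
  have hF := hw1.trans_lt hc1
  simp only [fNorm, iInf_lt_iff] at hF
  obtain ⟨f, hf, hqe, hfc⟩ := hF
  have hae : ∀ᵐ x, w x ^ (1 / r) ≤ rieszPotential α f x :=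
    measure_eq_zero_of_rieszCap_eq_zero hs hα hαs hqe
  have hc0 : c ≠ 0 := (zero_lt_one.trans hc1).ne'
  set a : ℝ≥0∞ := c ^ (-(1 / r)) with ha
  have ha0 : a ≠ 0 := (ENNReal.rpow_pos (pos_iff_ne_zero.2 hc0) hct.ne).ne'
  have hat : a ≠ ∞ := ENNReal.rpow_ne_top_of_ne_zero hc0 hct.ne
  refine ⟨fun x => a * f x, by fun_prop, ?_, ?_⟩
  · simp_rw [ENNReal.mul_rpow_of_nonneg _ _ hs0.le]
    rw [lintegral_const_mul' _ _ (ENNReal.rpow_ne_top_of_nonneg hs0.le hat)]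
    have h1 : ∫⁻ x, f x ^ s ≤ c ^ (s / r) := by
      have := ENNReal.rpow_le_rpow hfc.le (by positivity : 0 ≤ s / r)
      rwa [← ENNReal.rpow_mul, show r / s * (s / r) = 1 by field_simp, ENNReal.rpow_one] at this
    calc a ^ s * ∫⁻ x, f x ^ s ≤ a ^ s * c ^ (s / r) := by gcongr
      _ = 1 := by
        rw [ha, ← ENNReal.rpow_mul, ← ENNReal.rpow_add _ _ hc0 hct.ne,
          show -(1 / r) * s + s / r = 0 by ring, ENNReal.rpow_zero]
  · refine lt_of_le_of_lt (ENNReal.rpow_le_rpow ?_ (by positivity)) hcL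
    rw [hv, ← lintegral_const_mul' _ _ (ENNReal.rpow_ne_top_of_nonneg (by linarith) hct.ne)]
    refine lintegral_mono_ae ?_
    filter_upwards [hae] with x hx
    rw [rieszPotential_const_mul hf, mul_left_comm]
    gcongr
    have hneg : r * (1 - q) < 0 := mul_neg_of_pos_of_neg hr (by linarith)
    refine (ennreal_rpow_le_rpow_of_nonpos hneg.le (mul_le_mul' le_rfl hx)).trans ?_
    rcases eq_or_ne (w x) ∞ with hwx | hwx
    · rw [hwx, ENNReal.top_rpow_of_pos (by positivity), ENNReal.mul_top ha0,
        ENNReal.top_rpow_of_neg hneg]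
      exact bot_le
    · rw [ENNReal.mul_rpow_of_ne_top hat (ENNReal.rpow_ne_top_of_nonneg (by positivity) hwx),
        ha, ← ENNReal.rpow_mul, ← ENNReal.rpow_mul,
        show -(1 / r) * (r * (1 - q)) = q - 1 by field_simp; ring,
        show 1 / r * (r * (1 - q)) = 1 - q by field_simp]

theorem nbarMetric_mono_ae (hq : 1 < q) {f g : EuclideanSpace ℝ (Fin n) → ℝ≥0∞}
    (h : f ≤ᵐ[volume] g) : nbarMetric α s r q f ≤ nbarMetric α s r q g := by
  have hq0 : 0 < q := by linarith
  refine iInf_mono fun w => iInf_mono fun _ => iInf_mono fun _ => ?_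
  refine ENNReal.rpow_le_rpow (lintegral_mono_ae ?_) (by positivity)
  filter_upwards [h] with x hx
  gcongr

theorem nbarMetric_eq_zero_of_ae_eq_zero (hs : 1 < s) (hα : 0 < α) (hαs : α < n / s) (hr : 0 < r)
    (hrs : r ≤ s) (hq : 1 < q) {g : EuclideanSpace ℝ (Fin n) → ℝ≥0∞} (hg : g =ᵐ[volume] 0) :
    nbarMetric α s r q g = 0 := by
  have hq0 : 0 < q := by linarith
  have hs0 : 0 < s := by linarith
  refine le_antisymm ((nbarMetric_le hs hα hαs hr hrs (f := 0) aemeasurable_const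
    (by simp [hs0])).trans (le_of_eq ?_)) bot_le
  have : ∫⁻ x, g x ^ q * rieszPotential α 0 x ^ (r * (1 - q)) = 0 := by
    rw [lintegral_eq_zero_of_ae_eq_zero]
    filter_upwards [hg] with x hx
    simp [hx, hq0]
  rw [this, ENNReal.zero_rpow_of_pos (by positivity)]

theorem nbarMetric_const_mul (hs : 1 < s) (hα : 0 < α) (hαs : α < n / s) (hr : 0 < r)
    (hrs : r ≤ s) (hq : 1 < q) (c : ℝ≥0) (g : EuclideanSpace ℝ (Fin n) → ℝ≥0∞) :
    nbarMetric α s r q (fun x => c * g x) = c * nbarMetric α s r q g := by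
  have hq0 : 0 < q := by linarith
  rcases eq_or_ne c 0 with rfl | hc
  · rw [nbarMetric_eq_zero_of_ae_eq_zero hs hα hαs hr hrs hq]
    · simp
    · exact Eventually.of_forall fun x => by simp
  have hc0 : (c : ℝ≥0∞) ≠ 0 := by simpa using hc
  unfold nbarMetric
  simp_rw [ENNReal.mul_iInf_of_ne hc0 ENNReal.coe_ne_top]
  refine iInf_congr fun w => iInf_congr fun _ => iInf_congr fun _ => ?_
  simp_rw [ENNReal.mul_rpow_of_nonneg _ _ hq0.le, mul_assoc]
  rw [lintegral_const_mul' _ _ (ENNReal.rpow_ne_top_of_nonneg hq0.le ENNReal.coe_ne_top),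
    ENNReal.mul_rpow_of_nonneg _ _ (by positivity), ← ENNReal.rpow_mul,
    mul_one_div_cancel hq0.ne', ENNReal.rpow_one]

/-- Near-optimal `f₁`, `f₂` are merged into `(θ₁ f₁ ^ s + θ₂ f₂ ^ s) ^ (1 / s)`, with `θᵢ`
proportional to the near-optimal values `bᵢ`. This choice makes the two terms `θᵢ ^ (1 - q) * bᵢ ^
q` add up to exactly `(b₁ + b₂) ^ q`. -/
theorem nbarMetric_add_le (hs : 1 < s) (hα : 0 < α) (hαs : α < n / s) (hr : 0 < r)
    (hrs : r ≤ s) (hq : 1 < q) {g₁ g₂ : EuclideanSpace ℝ (Fin n) → ℝ≥0∞}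
    (hg₁ : AEMeasurable g₁ volume) :
    nbarMetric α s r q (fun x => g₁ x + g₂ x) ≤
      nbarMetric α s r q g₁ + nbarMetric α s r q g₂ := by
  have hq0 : 0 < q := by linarith
  have hs0 : 0 < s := by linarith
  refine ENNReal.le_of_forall_pos_le_add fun ε hε hfin => ?_
  obtain ⟨h1t, h2t⟩ := ENNReal.add_lt_top.1 hfin
  have hε2 : (ε / 2 : ℝ≥0∞) ≠ 0 := by simp [hε.ne']
  have hε2t : (ε / 2 : ℝ≥0∞) ≠ ∞ := ENNReal.div_ne_top ENNReal.coe_ne_top (by simp)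
  -- The added `ε / 2` also keeps `bᵢ`, hence `θᵢ`, nonzero when a norm vanishes.
  set b₁ := nbarMetric α s r q g₁ + ε / 2 with hb₁
  set b₂ := nbarMetric α s r q g₂ + ε / 2 with hb₂
  obtain ⟨f₁, hf₁, hf₁s, hf₁b⟩ := exists_of_nbarMetric_lt hs hα hαs hr hq
    (ENNReal.lt_add_right h1t.ne hε2)
  obtain ⟨f₂, hf₂, hf₂s, hf₂b⟩ := exists_of_nbarMetric_lt hs hα hαs hr hq
    (ENNReal.lt_add_right h2t.ne hε2)
  rw [← hb₁] at hf₁b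
  rw [← hb₂] at hf₂b
  have hb₁0 : b₁ ≠ 0 := by simp [hb₁, hε.ne']
  have hb₂0 : b₂ ≠ 0 := by simp [hb₂, hε.ne']
  have hb₁t : b₁ ≠ ∞ := ENNReal.add_ne_top.2 ⟨h1t.ne, hε2t⟩
  have hb₂t : b₂ ≠ ∞ := ENNReal.add_ne_top.2 ⟨h2t.ne, hε2t⟩
  set A := b₁ + b₂ with hA
  have hA0 : A ≠ 0 := by simp [hA, hb₁0]
  have hAt : A ≠ ∞ := ENNReal.add_ne_top.2 ⟨hb₁t, hb₂t⟩
  have hAeq : nbarMetric α s r q g₁ + nbarMetric α s r q g₂ + ε = A := by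
    nth_rw 1 [hA, hb₁, hb₂, ← ENNReal.add_halves (ε : ℝ≥0∞)]
    ring
  rw [hAeq]
  set θ₁ := b₁ * A⁻¹ with hθ₁
  set θ₂ := b₂ * A⁻¹ with hθ₂
  have hθ : θ₁ + θ₂ = 1 := by rw [hθ₁, hθ₂, ← add_mul, ENNReal.mul_inv_cancel hA0 hAt]
  have hθ₁0 : θ₁ ≠ 0 := mul_ne_zero hb₁0 (by simpa using hAt)
  have hθ₂0 : θ₂ ≠ 0 := mul_ne_zero hb₂0 (by simpa using hAt)
  have hθ₁t : θ₁ ≠ ∞ := ENNReal.mul_ne_top hb₁t (by simpa using hA0)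
  have hθ₂t : θ₂ ≠ ∞ := ENNReal.mul_ne_top hb₂t (by simpa using hA0)
  have hfs : ∫⁻ x, ((θ₁ * f₁ x ^ s + θ₂ * f₂ x ^ s) ^ (1 / s)) ^ s ≤ 1 := by
    simp_rw [← ENNReal.rpow_mul, one_div_mul_cancel hs0.ne', ENNReal.rpow_one]
    rw [lintegral_add_left' (by fun_prop), lintegral_const_mul' _ _ hθ₁t,
      lintegral_const_mul' _ _ hθ₂t, ← hθ]
    nth_rw 2 [← mul_one θ₁, ← mul_one θ₂]
    gcongr
  refine (nbarMetric_le hs hα hαs hr hrs (by fun_prop) hfs).trans ?_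
  have hfin₁ := rieszPotential_ae_lt_top hs hα hαs hf₁ (hf₁s.trans_lt ENNReal.one_lt_top).ne
  have hfin₂ := rieszPotential_ae_lt_top hs hα hαs hf₂ (hf₂s.trans_lt ENNReal.one_lt_top).ne
  have hpow : ∀ (θ b Φ : ℝ≥0∞), θ = b * A⁻¹ → b ≠ 0 → b ≠ ∞ → Φ ^ (1 / q) < b →
      θ ^ (1 - q) * Φ ≤ b * A ^ (q - 1) := by
    intro θ b Φ hθ hb0 hbt hΦ
    have h1 : Φ ≤ b ^ q := by
      have := ENNReal.rpow_le_rpow hΦ.le hq0.le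
      rwa [← ENNReal.rpow_mul, one_div_mul_cancel hq0.ne', ENNReal.rpow_one] at this
    calc θ ^ (1 - q) * Φ ≤ θ ^ (1 - q) * b ^ q := by gcongr
      _ = (b ^ (1 - q) * b ^ q) * A⁻¹ ^ (1 - q) := by
        rw [hθ, ENNReal.mul_rpow_of_ne_top hbt (by simpa using hA0)]; ring
      _ = _ := by
        rw [← ENNReal.rpow_add _ _ hb0 hbt, sub_add_cancel, ENNReal.rpow_one, ENNReal.inv_rpow,
          ← ENNReal.rpow_neg, neg_sub]
  have hX : ∀ (θ X : ℝ≥0∞), θ ≠ ∞ → X < ∞ →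
      (θ * X ^ r) ^ (1 - q) = θ ^ (1 - q) * X ^ (r * (1 - q)) := by
    intro θ X hθ hX
    rw [ENNReal.mul_rpow_of_ne_top hθ (ENNReal.rpow_ne_top_of_nonneg hr.le hX.ne),
      ENNReal.rpow_mul]
  have hmain : ∫⁻ x, (g₁ x + g₂ x) ^ q * rieszPotential α
      (fun y => (θ₁ * f₁ y ^ s + θ₂ * f₂ y ^ s) ^ (1 / s)) x ^ (r * (1 - q)) ≤ A ^ q := by
    calc _ ≤ ∫⁻ x, (θ₁ ^ (1 - q) * (g₁ x ^ q * rieszPotential α f₁ x ^ (r * (1 - q))) +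
            θ₂ ^ (1 - q) * (g₂ x ^ q * rieszPotential α f₂ x ^ (r * (1 - q)))) := by
          refine lintegral_mono_ae ?_
          filter_upwards [hfin₁, hfin₂] with x hx₁ hx₂
          have hm := add_rieszPotential_rpow_le hs hf₁ hf₂ hθ₁t hθ₂t hx₁.ne hx₂.ne
          have hpm := ENNReal.rpow_arith_mean_le_arith_mean2_rpow θ₁ θ₂
            (rieszPotential α f₁ x ^ r) (rieszPotential α f₂ x ^ r) hθ
            (p := s / r) ((one_le_div hr).2 hrs)
          simp_rw [← ENNReal.rpow_mul, mul_div_cancel₀ s hr.ne'] at hpm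
          -- The power mean inequality with exponent `s / r ≥ 1`, then Minkowski; `r ≤ s` is
          -- essential here.
          have hle : θ₁ * rieszPotential α f₁ x ^ r + θ₂ * rieszPotential α f₂ x ^ r ≤
              rieszPotential α (fun y => (θ₁ * f₁ y ^ s + θ₂ * f₂ y ^ s) ^ (1 / s)) x ^ r := by
            have h1 := ENNReal.rpow_le_rpow hpm (by positivity : 0 ≤ r / s)
            rw [← ENNReal.rpow_mul, show s / r * (r / s) = 1 by field_simp,
              ENNReal.rpow_one] at h1
            refine h1.trans ?_
            have h2 := ENNReal.rpow_le_rpow hm hr.le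
            rwa [← ENNReal.rpow_mul, show 1 / s * r = r / s by ring] at h2
          rw [ENNReal.rpow_mul]
          calc _ ≤ (g₁ x + g₂ x) ^ q * (θ₁ * rieszPotential α f₁ x ^ r +
                θ₂ * rieszPotential α f₂ x ^ r) ^ (1 - q) := by
                exact mul_le_mul' le_rfl (ennreal_rpow_le_rpow_of_nonpos (by linarith) hle)
            _ ≤ _ := add_rpow_mul_add_rpow_le hq _ _ _ _
            _ = _ := by rw [hX _ _ hθ₁t hx₁, hX _ _ hθ₂t hx₂]; ring
      _ = θ₁ ^ (1 - q) * (∫⁻ x, g₁ x ^ q * rieszPotential α f₁ x ^ (r * (1 - q))) +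
            θ₂ ^ (1 - q) * ∫⁻ x, g₂ x ^ q * rieszPotential α f₂ x ^ (r * (1 - q)) := by
          have := measurable_rieszPotential (α := α) hf₁
          rw [lintegral_add_left' (by fun_prop),
            lintegral_const_mul' _ _ (ENNReal.rpow_ne_top_of_ne_zero hθ₁0 hθ₁t),
            lintegral_const_mul' _ _ (ENNReal.rpow_ne_top_of_ne_zero hθ₂0 hθ₂t)]
      _ ≤ b₁ * A ^ (q - 1) + b₂ * A ^ (q - 1) :=
          add_le_add (hpow _ _ _ hθ₁ hb₁0 hb₁t hf₁b) (hpow _ _ _ hθ₂ hb₂0 hb₂t hf₂b)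
      _ = A ^ q := by
          rw [← add_mul, ← hA]
          nth_rw 1 [← ENNReal.rpow_one A]
          rw [← ENNReal.rpow_add _ _ hA0 hAt, add_sub_cancel]
  refine (ENNReal.rpow_le_rpow hmain (by positivity)).trans ?_
  rw [← ENNReal.rpow_mul, mul_one_div_cancel hq0.ne', ENNReal.rpow_one]

theorem nbarMetric_indicator_lt_top (hs : 1 < s) (hα : 0 < α) (hαs : α < n / s) (hr : 0 < r)
    (hrs : r ≤ s) (hq : 1 < q) {A : Set (EuclideanSpace ℝ (Fin n))}
    (hA : Bornology.IsBounded A) : nbarMetric α s r q (A.indicator 1) < ∞ := by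
  have hq0 : 0 < q := by linarith
  have hs0 : 0 < s := by linarith
  have hαn : α < n := hαs.trans_le (div_le_self n.cast_nonneg hs.le)
  obtain ⟨R, hR, hAR⟩ := hA.subset_ball_lt 0 0
  obtain ⟨c, hc0, hc⟩ := exists_le_rieszPotential_ball hα hαn hR
  set B : Set (EuclideanSpace ℝ (Fin n)) := Metric.ball 0 R with hB
  have hBm : MeasurableSet B := Metric.isOpen_ball.measurableSet
  have hV : volume B < ∞ := Metric.isBounded_ball.measure_lt_top
  -- This scales the indicator of the ball into the unit ball of `L^s`.
  set a : ℝ≥0∞ := (1 + volume B) ^ (-(1 / s)) with ha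
  have hV1 : 1 + volume B ≠ 0 := by simp
  have hV2 : 1 + volume B ≠ ∞ := by simp [hV.ne]
  have ha0 : a ≠ 0 := (ENNReal.rpow_pos (pos_iff_ne_zero.2 hV1) hV2).ne'
  have hat : a ≠ ∞ := ENNReal.rpow_ne_top_of_ne_zero hV1 hV2
  have hBi : AEMeasurable (B.indicator (1 : EuclideanSpace ℝ (Fin n) → ℝ≥0∞)) volume :=
    (measurable_one.indicator hBm).aemeasurable
  have hfs : ∫⁻ x, (a * B.indicator 1 x) ^ s ≤ 1 := by
    have : ∀ x, (a * B.indicator 1 x) ^ s = a ^ s * B.indicator 1 x := by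
      intro x
      by_cases hx : x ∈ B <;> simp [hx, hs0]
    simp_rw [this]
    rw [lintegral_const_mul' _ _ (ENNReal.rpow_ne_top_of_nonneg hs0.le hat),
      lintegral_indicator_one hBm, ha, ← ENNReal.rpow_mul, neg_mul, one_div_mul_cancel hs0.ne',
      ENNReal.rpow_neg_one]
    calc _ ≤ (1 + volume B)⁻¹ * (1 + volume B) := by gcongr; exact le_add_self
      _ = 1 := ENNReal.inv_mul_cancel hV1 hV2
  refine (nbarMetric_le hs hα hαs hr hrs (by fun_prop) hfs).trans_lt ?_
  refine ENNReal.rpow_lt_top_of_nonneg (by positivity) (ne_of_lt ?_)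
  have hneg : r * (1 - q) < 0 := mul_neg_of_pos_of_neg hr (by linarith)
  calc _ ≤ ∫⁻ x, B.indicator (fun _ => (a * c) ^ (r * (1 - q))) x := by
        refine lintegral_mono fun x => ?_
        by_cases hx : x ∈ A
        · rw [Set.indicator_of_mem hx, Set.indicator_of_mem (hAR hx), Pi.one_apply,
            ENNReal.one_rpow, one_mul, rieszPotential_const_mul hBi]
          exact ennreal_rpow_le_rpow_of_nonpos hneg.le (mul_le_mul' le_rfl (hc x (hAR hx)))
        · simp [Set.indicator_of_notMem hx, hq0]
    _ = (a * c) ^ (r * (1 - q)) * volume B := by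
        rw [lintegral_indicator hBm, setLIntegral_const]
    _ < ∞ := by
        refine ENNReal.mul_lt_top (lt_top_iff_ne_top.2 fun h => ?_) hV
        rw [ENNReal.rpow_eq_top_iff] at h
        rcases h with h | h
        · exact (mul_ne_zero ha0 hc0.ne') h.1
        · exact absurd h.2 hneg.not_gt

/-- Hölder applied to `g = (g X ^ (-r / q')) * X ^ (r / q')` with `X = I_α f`: the first factor
gives the energy, the second the uniformly bounded local integral of `X ^ r`. -/
theorem exists_setLIntegral_le_nbarMetric (hs : 1 < s) (hα : 0 < α) (hαs : α < n / s)
    (hr : 0 < r) (hrs : r ≤ s) (hq : 1 < q) {A : Set (EuclideanSpace ℝ (Fin n))}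
    (hA : Bornology.IsBounded A) : ∃ C : ℝ≥0, ∀ g : EuclideanSpace ℝ (Fin n) → ℝ≥0∞,
      AEMeasurable g volume → ∫⁻ x in A, g x ≤ C * nbarMetric α s r q g := by
  have hq0 : 0 < q := by linarith
  obtain ⟨R, hAR⟩ := hA.subset_ball 0
  obtain ⟨C, hC⟩ := exists_setLIntegral_rieszPotential_rpow_le_of_le (n := n) hs hα hαs hr hrs R
  have hpq : q.HolderConjugate (q / (q - 1)) := .conjExponent hq
  set q' := q / (q - 1) with hq'
  have hq'0 : 0 ≤ 1 / q' := by have := hpq.symm.pos; positivity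
  -- The added `1` makes `D` nonzero, so that it can be moved across the inequality.
  set D : ℝ≥0 := (C + 1) ^ (1 / q') with hD
  have hD0 : (D : ℝ≥0∞) ≠ 0 := by
    have : 0 < D := NNReal.rpow_pos (by positivity)
    simpa using this.ne'
  refine ⟨D, fun g hg => ?_⟩
  rw [mul_comm, ← ENNReal.div_le_iff hD0 ENNReal.coe_ne_top]
  refine le_of_forall_gt fun L hL => ?_
  obtain ⟨f, hf, hfs, hfL⟩ := exists_of_nbarMetric_lt hs hα hαs hr hq hL
  refine lt_of_le_of_lt ?_ hfL
  rw [ENNReal.div_le_iff hD0 ENNReal.coe_ne_top]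
  set Φ := ∫⁻ x, g x ^ q * rieszPotential α f x ^ (r * (1 - q)) with hΦ
  rcases eq_or_ne Φ ∞ with hΦt | hΦt
  · rw [hΦt, ENNReal.top_rpow_of_pos (by positivity), ENNReal.top_mul hD0]
    exact le_top
  have hm := measurable_rieszPotential (α := α) hf
  have hfin := rieszPotential_ae_lt_top hs hα hαs hf (hfs.trans_lt ENNReal.one_lt_top).ne
  have hneg : r * (1 - q) < 0 := mul_neg_of_pos_of_neg hr (by linarith)
  have hΦae := ae_lt_top' (by fun_prop) hΦt
  have hpt : ∀ᵐ x, g x ≤ (g x * rieszPotential α f x ^ (-(r / q'))) *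
      rieszPotential α f x ^ (r / q') := by
    filter_upwards [hfin, hΦae] with x hx hx'
    rcases eq_or_ne (g x) 0 with h0 | h0
    · simp [h0]
    -- A zero potential under `g x ≠ 0` would make the energy density infinite, which a finite
    -- energy allows only on a null set.
    have hX0 : rieszPotential α f x ≠ 0 := by
      intro h
      rw [h, ENNReal.zero_rpow_of_neg hneg, ENNReal.mul_top] at hx'
      · exact lt_irrefl _ hx'
      · simp [ENNReal.rpow_eq_zero_iff, h0, hq0.not_gt]
    rw [mul_assoc, ← ENNReal.rpow_add _ _ hX0 hx.ne]
    simp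
  have hexp : -(r / q') * q = r * (1 - q) := by
    rw [hq']; field_simp; ring
  have hexp' : r / q' * q' = r := div_mul_cancel₀ _ hpq.symm.pos.ne'
  calc ∫⁻ x in A, g x ≤ ∫⁻ x in Metric.ball 0 R, g x := lintegral_mono_set hAR
    _ ≤ ∫⁻ x in Metric.ball 0 R, ((fun x => g x * rieszPotential α f x ^ (-(r / q'))) *
          fun x => rieszPotential α f x ^ (r / q')) x :=
        lintegral_mono_ae (ae_restrict_of_ae hpt)
    _ ≤ _ := ENNReal.lintegral_mul_le_Lp_mul_Lq _ hpq (by fun_prop) (by fun_prop)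
    _ ≤ Φ ^ (1 / q) * D := by
        simp_rw [ENNReal.mul_rpow_of_nonneg _ _ hq0.le, ← ENNReal.rpow_mul, hexp, hexp']
        gcongr
        · exact setLIntegral_le_lintegral _ _
        · rw [hD, ENNReal.coe_rpow_of_nonneg _ hq'0]
          refine ENNReal.rpow_le_rpow ((hC f hf hfs).trans ?_) hq'0
          exact_mod_cast le_self_add

theorem nbarMetric_eq_zero_iff (hs : 1 < s) (hα : 0 < α) (hαs : α < n / s) (hr : 0 < r)
    (hrs : r ≤ s) (hq : 1 < q) {g : EuclideanSpace ℝ (Fin n) → ℝ≥0∞}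
    (hg : AEMeasurable g volume) : nbarMetric α s r q g = 0 ↔ g =ᵐ[volume] 0 := by
  refine ⟨fun h => ?_, nbarMetric_eq_zero_of_ae_eq_zero hs hα hαs hr hrs hq⟩
  refine ae_of_forall_restrict_ball fun R => ?_
  obtain ⟨C, hC⟩ := exists_setLIntegral_le_nbarMetric (n := n) hs hα hαs hr hrs hq
    (Metric.isBounded_ball (x := (0 : EuclideanSpace ℝ (Fin n))) (r := (R : ℝ)))
  have := hC g hg
  rw [h, mul_zero] at this
  exact (lintegral_eq_zero_iff' hg.restrict).1 (le_antisymm this bot_le)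

end metric

/-! ### Intersections of nested convex sets. -/

/-- Nested sequences of nonempty closed midpoint-convex sets have a common point, if there is a
bounded uniformly convex function on the first of them. -/
theorem nonempty_iInter_of_uniformly_convex {E : Type*} [NormedAddCommGroup E] [NormedSpace ℝ E]
    [CompleteSpace E] {C : ℕ → Set E} (hanti : Antitone C) (hclosed : ∀ j, IsClosed (C j))
    (hne : ∀ j, (C j).Nonempty)
    (hmid : ∀ j, ∀ x ∈ C j, ∀ y ∈ C j, (2⁻¹ : ℝ) • x + (2⁻¹ : ℝ) • y ∈ C j)
    {φ : E → ℝ} (h0 : ∀ x ∈ C 0, 0 ≤ φ x) (h1 : ∀ x ∈ C 0, φ x ≤ 1)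
    (huc : ∀ η > 0, ∃ δ > 0, ∀ x ∈ C 0, ∀ y ∈ C 0, η ≤ ‖x - y‖ →
      φ ((2⁻¹ : ℝ) • x + (2⁻¹ : ℝ) • y) ≤ (φ x + φ y) / 2 - δ) :
    (⋂ j, C j).Nonempty := by
  have hC0 : ∀ j, C j ⊆ C 0 := fun j => hanti (Nat.zero_le j)
  set m : ℕ → ℝ := fun j => sInf (φ '' C j) with hm
  have hbdd : ∀ j, BddBelow (φ '' C j) := fun j => ⟨0, by
    rintro _ ⟨x, hx, rfl⟩; exact h0 x (hC0 j hx)⟩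
  have hmle : ∀ j, ∀ x ∈ C j, m j ≤ φ x := fun j x hx => csInf_le (hbdd j) ⟨x, hx, rfl⟩
  have hmono : Monotone m := fun i j hij =>
    csInf_le_csInf (hbdd i) ((hne j).image φ) (Set.image_mono (hanti hij))
  have hmb : BddAbove (Set.range m) := ⟨1, by
    rintro _ ⟨j, rfl⟩
    obtain ⟨x, hx⟩ := hne j
    exact (hmle j x hx).trans (h1 x (hC0 j hx))⟩
  set M := ⨆ j, m j with hM
  have hmM : ∀ j, m j ≤ M := fun j => le_ciSup hmb j
  have hlim : Tendsto m atTop (𝓝 M) := tendsto_atTop_ciSup hmono hmb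
  have hx : ∀ j : ℕ, ∃ x ∈ C j, φ x < m j + 1 / ((j : ℝ) + 1) := by
    intro j
    obtain ⟨_, ⟨x, hx, rfl⟩, hlt⟩ := exists_lt_of_csInf_lt ((hne j).image φ)
      (show sInf (φ '' C j) < m j + 1 / ((j : ℝ) + 1) from lt_add_of_pos_right _ (by positivity))
    exact ⟨x, hx, hlt⟩
  choose x hxC hxφ using hx
  -- The midpoint of two late near-minimizers stays in `C N`, where `φ ≥ m N > M - δ / 2`. If they
  -- were `η` apart, uniform convexity would put its value below `M + δ / 2 - δ`.
  have hcauchy : CauchySeq x := by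
    refine Metric.cauchySeq_iff.2 fun η hη => ?_
    obtain ⟨δ, hδ, hδ'⟩ := huc η hη
    have e1 : ∀ᶠ j in atTop, M - δ / 2 < m j := hlim.eventually (lt_mem_nhds (by linarith))
    have e2 : ∀ᶠ j : ℕ in atTop, 1 / ((j : ℝ) + 1) < δ / 2 :=
      (tendsto_one_div_add_atTop_nhds_zero_nat (𝕜 := ℝ)).eventually (gt_mem_nhds (by linarith))
    obtain ⟨N, hN1, hN2⟩ := (e1.and e2).exists
    refine ⟨N, fun i hi j hj => ?_⟩
    by_contra! h
    rw [dist_eq_norm] at h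
    have hk : ∀ k ≥ N, φ (x k) < M + δ / 2 := by
      intro k hk
      have : 1 / ((k : ℝ) + 1) ≤ 1 / ((N : ℝ) + 1) := by gcongr
      linarith [hxφ k, hmM k]
    have h2 := hδ' (x i) (hC0 _ (hxC i)) (x j) (hC0 _ (hxC j)) h
    have h3 := hmle N _ (hmid N _ (hanti hi (hxC i)) _ (hanti hj (hxC j)))
    linarith [hk i hi, hk j hj]
  obtain ⟨z, hz⟩ := cauchySeq_tendsto_of_complete hcauchy
  refine ⟨z, Set.mem_iInter.2 fun j => ?_⟩
  exact (hclosed j).mem_of_tendsto hz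
    (eventually_atTop.2 ⟨j, fun k hk => hanti hk (hxC k)⟩)

/-! ### Uniform convexity of `‖·‖ ^ s` on the nonnegative unit ball of `L^s`. -/

section Lp

variable {X : Type*} [MeasurableSpace X] {μ : Measure X} {s : ℝ}

theorem ofReal_norm_rpow_eq_lintegral [Fact (1 ≤ ENNReal.ofReal s)] (hs : 1 < s) (f : Lp ℝ (ENNReal.ofReal s) μ) :
    ENNReal.ofReal (‖f‖ ^ s) = ∫⁻ x, ‖f x‖ₑ ^ s ∂μ := by
  have hs0 : 0 < s := by linarith
  rw [← ENNReal.ofReal_rpow_of_nonneg (norm_nonneg _) hs0.le, ofReal_norm, Lp.enorm_def,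
    eLpNorm_eq_lintegral_rpow_enorm_toReal (by simpa using hs0) (by simp),
    ENNReal.toReal_ofReal hs0.le, ← ENNReal.rpow_mul, one_div_mul_cancel hs0.ne', ENNReal.rpow_one]

theorem Lp_norm_rpow_uniformly_convex [Fact (1 ≤ ENNReal.ofReal s)] (hs : 1 < s) {η : ℝ} (hη : 0 < η) :
    ∃ δ > 0, ∀ f g : Lp ℝ (ENNReal.ofReal s) μ, 0 ≤ f → 0 ≤ g → ‖f‖ ≤ 1 → ‖g‖ ≤ 1 →
      η ≤ ‖f - g‖ →
      ‖(2⁻¹ : ℝ) • f + (2⁻¹ : ℝ) • g‖ ^ s ≤ (‖f‖ ^ s + ‖g‖ ^ s) / 2 - δ := by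
  have hs0 : 0 < s := by linarith
  have hηs : 0 < η ^ s := Real.rpow_pos_of_pos hη s
  -- As `‖f‖ ^ s + ‖g‖ ^ s ≤ 2`, this `ε` contributes at most `η ^ s / 2`, half of `‖f - g‖ ^ s`;
  -- the other half, divided by `K`, is the gain `δ`.
  obtain ⟨K, hK, hKab⟩ := exists_abs_sub_rpow_le hs (ε := η ^ s / 4) (by positivity)
  refine ⟨η ^ s / (2 * K), by positivity, fun f g hf hg hf1 hg1 hfg => ?_⟩
  have main : ‖f - g‖ ^ s + K * ‖(2⁻¹ : ℝ) • f + (2⁻¹ : ℝ) • g‖ ^ s ≤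
      (η ^ s / 4 + K / 2) * (‖f‖ ^ s + ‖g‖ ^ s) := by
    rw [← ENNReal.ofReal_le_ofReal_iff (by positivity), ENNReal.ofReal_add (by positivity)
      (by positivity), ENNReal.ofReal_mul hK.le, ENNReal.ofReal_mul (by positivity),
      ENNReal.ofReal_add (p := ‖f‖ ^ s) (by positivity) (by positivity)]
    simp_rw [ofReal_norm_rpow_eq_lintegral hs]
    have m1 := (Lp.aestronglyMeasurable f).aemeasurable
    have m2 := (Lp.aestronglyMeasurable g).aemeasurable
    have m3 := (Lp.aestronglyMeasurable (f - g)).aemeasurable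
    rw [← lintegral_const_mul' _ _ ENNReal.ofReal_ne_top, ← lintegral_add_left' (by fun_prop),
      ← lintegral_add_left' (by fun_prop), ← lintegral_const_mul' _ _ ENNReal.ofReal_ne_top]
    refine lintegral_mono_ae ?_
    filter_upwards [(Lp.coeFn_nonneg f).2 hf, (Lp.coeFn_nonneg g).2 hg, Lp.coeFn_sub f g,
      Lp.coeFn_add ((2⁻¹ : ℝ) • f) ((2⁻¹ : ℝ) • g), Lp.coeFn_smul (2⁻¹ : ℝ) f,
      Lp.coeFn_smul (2⁻¹ : ℝ) g] with x hfx hgx h1 h2 h3 h4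
    simp only [Pi.zero_apply] at hfx hgx
    have h := hKab (f x) (g x) hfx hgx
    have e : ∀ y : ℝ, ‖y‖ₑ ^ s = ENNReal.ofReal (|y| ^ s) := fun y => by
      rw [← ENNReal.ofReal_rpow_of_nonneg (abs_nonneg _) hs0.le, Real.enorm_eq_ofReal_abs]
    rw [h1, h2, Pi.sub_apply, Pi.add_apply, h3, h4, Pi.smul_apply, Pi.smul_apply, e, e, e, e,
      ← ENNReal.ofReal_mul hK.le, ← ENNReal.ofReal_add (by positivity) (by positivity),
      ← ENNReal.ofReal_add (by positivity) (by positivity), ← ENNReal.ofReal_mul (by positivity)]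
    refine ENNReal.ofReal_le_ofReal ?_
    rw [smul_eq_mul, smul_eq_mul, abs_of_nonneg hfx, abs_of_nonneg hgx,
      show (2⁻¹ : ℝ) * f x + 2⁻¹ * g x = (f x + g x) / 2 by ring,
      abs_of_nonneg (a := (f x + g x) / 2) (by positivity)]
    exact h
  have hf2 : ‖f‖ ^ s ≤ 1 := Real.rpow_le_one (norm_nonneg _) hf1 hs0.le
  have hg2 : ‖g‖ ^ s ≤ 1 := Real.rpow_le_one (norm_nonneg _) hg1 hs0.le
  have hfg2 : η ^ s ≤ ‖f - g‖ ^ s := Real.rpow_le_rpow hη.le hfg hs0.le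
  have h3 : K * ‖(2⁻¹ : ℝ) • f + (2⁻¹ : ℝ) • g‖ ^ s ≤
      K * ((‖f‖ ^ s + ‖g‖ ^ s) / 2 - η ^ s / (2 * K)) := by
    have : K * ((‖f‖ ^ s + ‖g‖ ^ s) / 2 - η ^ s / (2 * K)) =
        K / 2 * (‖f‖ ^ s + ‖g‖ ^ s) - η ^ s / 2 := by field_simp
    rw [this]
    nlinarith
  exact le_of_mul_le_mul_left h3 hK

end Lp

/-! ### Closedness of energy sublevel sets and the Fatou property. -/

section fatou

variable {n : ℕ} {α s r q : ℝ}

/-- A sequence converging in `L^s` has a subsequence along which the Riesz potentials converge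
almost everywhere. -/
theorem exists_subseq_tendsto_rieszPotential [Fact (1 ≤ ENNReal.ofReal s)] (hs : 1 < s)
    (hα : 0 < α) (hαs : α < n / s)
    {F : ℕ → Lp ℝ (ENNReal.ofReal s) (volume : Measure (EuclideanSpace ℝ (Fin n)))}
    {f : Lp ℝ (ENNReal.ofReal s) (volume : Measure (EuclideanSpace ℝ (Fin n)))}
    (hF : Tendsto F atTop (𝓝 f)) :
    ∃ φ : ℕ → ℕ, StrictMono φ ∧ ∀ᵐ x, Tendsto
      (fun k => rieszPotential α (fun y => ENNReal.ofReal (F (φ k) y)) x) atTop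
      (𝓝 (rieszPotential α (fun y => ENNReal.ofReal (f y)) x)) := by
  have hs0 : 0 < s := by linarith
  have hpos : ∀ k : ℕ, ∀ᶠ j in atTop, ‖F j - f‖ < (1 / 2) ^ k := by
    intro k
    have := (tendsto_iff_norm_sub_tendsto_zero.1 hF).eventually
      (gt_mem_nhds (show (0 : ℝ) < (1 / 2) ^ k by positivity))
    exact this
  obtain ⟨φ, hφ, hφk⟩ := extraction_forall_of_eventually hpos
  refine ⟨φ, hφ, ?_⟩
  -- Along this fast subsequence `∑ D k` lies in `L^s`, so its potential is finite a.e. Hence the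
  -- potentials of `D k` are summable and tend to zero a.e., and they bound the distance between the
  -- potentials of `F (φ k)` and `f`.
  set D : ℕ → EuclideanSpace ℝ (Fin n) → ℝ≥0∞ := fun k x => ‖(F (φ k) - f) x‖ₑ with hD
  have hDm : ∀ k, AEMeasurable (D k) volume := fun k =>
    (Lp.aestronglyMeasurable (F (φ k) - f)).enorm
  have hD2 : ∀ k, eLpNorm (D k) (ENNReal.ofReal s) volume ≤ ENNReal.ofReal ((1 / 2) ^ k) := by
    intro k
    rw [hD, eLpNorm_enorm, ← Lp.enorm_def, ← ofReal_norm]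
    exact ENNReal.ofReal_le_ofReal (hφk k).le
  have hsum : ∫⁻ x, (∑' k, D k x) ^ s ≠ ∞ := by
    have hpart : ∀ N : ℕ, ∫⁻ x, (∑ k ∈ Finset.range N, D k x) ^ s ≤ 2 ^ s := by
      intro N
      have h1 : eLpNorm (∑ k ∈ Finset.range N, D k) (ENNReal.ofReal s) volume ≤ 2 := by
        refine (eLpNorm_sum_le (fun k _ => (hDm k).aestronglyMeasurable) Fact.out).trans ?_
        refine (Finset.sum_le_sum fun k _ => hD2 k).trans ?_
        rw [← ENNReal.ofReal_sum_of_nonneg (fun k _ => by positivity)]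
        refine (ENNReal.ofReal_le_ofReal (sum_geometric_two_le N)).trans (by simp)
      rw [eLpNorm_eq_lintegral_rpow_enorm_toReal (by simpa using hs0) (by simp),
        ENNReal.toReal_ofReal hs0.le] at h1
      have h2 := ENNReal.rpow_le_rpow h1 hs0.le
      rw [← ENNReal.rpow_mul, one_div_mul_cancel hs0.ne', ENNReal.rpow_one] at h2
      simpa using h2
    have hlim : ∀ x, Tendsto (fun N => (∑ k ∈ Finset.range N, D k x) ^ s) atTop
        (𝓝 ((∑' k, D k x) ^ s)) := fun x =>
      (ENNReal.continuous_rpow_const.tendsto _).comp (ENNReal.tendsto_nat_tsum fun k => D k x)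
    have hT := lintegral_tendsto_of_tendsto_of_monotone
      (f := fun N x => (∑ k ∈ Finset.range N, D k x) ^ s) (μ := volume)
      (fun N => (Finset.aemeasurable_fun_sum _ fun k _ => hDm k).pow_const s)
      (Eventually.of_forall fun x => fun a b hab =>
        ENNReal.rpow_le_rpow (Finset.sum_le_sum_of_subset (Finset.range_mono hab)) hs0.le)
      (Eventually.of_forall hlim)
    exact ((le_of_tendsto' hT hpart).trans_lt
      (ENNReal.rpow_lt_top_of_nonneg hs0.le (by simp))).ne
  have hfin := rieszPotential_ae_lt_top hs hα hαs (f := fun x => ∑' k, D k x)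
    (AEMeasurable.tsum hDm) hsum
  have hffin : ∀ᵐ x, rieszPotential α (fun y => ENNReal.ofReal (f y)) x < ∞ := by
    have hm := (Lp.aestronglyMeasurable f).aemeasurable
    refine rieszPotential_ae_lt_top hs hα hαs (by fun_prop) ?_
    refine ((lintegral_mono fun x => ENNReal.rpow_le_rpow ?_ hs0.le).trans_lt
      ((ofReal_norm_rpow_eq_lintegral hs f).symm ▸ ENNReal.ofReal_lt_top)).ne
    rw [Real.enorm_eq_ofReal_abs]
    exact ENNReal.ofReal_le_ofReal (le_abs_self _)
  filter_upwards [hfin, hffin] with x hx hfx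
  rw [rieszPotential_tsum hDm] at hx
  have hzero := ENNReal.tendsto_atTop_zero_of_tsum_ne_top hx.ne
  have hub : ∀ k, rieszPotential α (fun y => ENNReal.ofReal (F (φ k) y)) x ≤
      rieszPotential α (fun y => ENNReal.ofReal (f y)) x + rieszPotential α (D k) x := by
    intro k
    have hm := (Lp.aestronglyMeasurable f).aemeasurable
    rw [← rieszPotential_add (by fun_prop)]
    refine rieszPotential_mono_ae ?_ x
    filter_upwards [Lp.coeFn_sub (F (φ k)) f] with y hy
    rw [hD]
    simp only [hy, Pi.sub_apply, Real.enorm_eq_ofReal_abs]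
    refine le_trans (ENNReal.ofReal_le_ofReal ?_) ENNReal.ofReal_add_le
    linarith [le_abs_self (F (φ k) y - f y)]
  have hlb : ∀ k, rieszPotential α (fun y => ENNReal.ofReal (f y)) x - rieszPotential α (D k) x ≤
      rieszPotential α (fun y => ENNReal.ofReal (F (φ k) y)) x := by
    intro k
    have hm := (Lp.aestronglyMeasurable (F (φ k))).aemeasurable
    rw [tsub_le_iff_right, ← rieszPotential_add (by fun_prop)]
    refine rieszPotential_mono_ae ?_ x
    filter_upwards [Lp.coeFn_sub (F (φ k)) f] with y hy
    rw [hD]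
    simp only [hy, Pi.sub_apply, Real.enorm_eq_ofReal_abs]
    refine le_trans (ENNReal.ofReal_le_ofReal ?_) ENNReal.ofReal_add_le
    linarith [neg_abs_le (F (φ k) y - f y)]
  refine tendsto_of_tendsto_of_tendsto_of_le_of_le ?_ ?_ hlb hub
  · have := ENNReal.Tendsto.sub (tendsto_const_nhds (x := rieszPotential α
      (fun y => ENNReal.ofReal (f y)) x)) hzero (Or.inl hfx.ne)
    simpa using this
  · simpa using (tendsto_const_nhds (x := rieszPotential α
      (fun y => ENNReal.ofReal (f y)) x)).add hzero

/-- Lower semicontinuity of the energy with respect to the convergence in `L^s`. -/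
theorem isClosed_setOf_lintegral_rieszPotential_le [Fact (1 ≤ ENNReal.ofReal s)] (hs : 1 < s)
    (hα : 0 < α) (hαs : α < n / s) {t : ℝ} {g : EuclideanSpace ℝ (Fin n) → ℝ≥0∞}
    (hg : AEMeasurable g volume) (L : ℝ≥0∞) :
    IsClosed {f : Lp ℝ (ENNReal.ofReal s) (volume : Measure (EuclideanSpace ℝ (Fin n))) |
      ∫⁻ x, g x * rieszPotential α (fun y => ENNReal.ofReal (f y)) x ^ t ≤ L} := by
  refine IsSeqClosed.isClosed fun F f hF hlim => ?_
  obtain ⟨φ, -, hφ⟩ := exists_subseq_tendsto_rieszPotential (α := α) hs hα hαs hlim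
  have hm : ∀ h : Lp ℝ (ENNReal.ofReal s) (volume : Measure (EuclideanSpace ℝ (Fin n))),
      Measurable (rieszPotential α (fun y => ENNReal.ofReal (h y))) := fun h => by
    have hm := (Lp.aestronglyMeasurable h).aemeasurable
    exact measurable_rieszPotential (by fun_prop)
  calc ∫⁻ x, g x * rieszPotential α (fun y => ENNReal.ofReal (f y)) x ^ t
      ≤ ∫⁻ x, liminf (fun k => g x *
          rieszPotential α (fun y => ENNReal.ofReal (F (φ k) y)) x ^ t) atTop := by
        refine lintegral_mono_ae ?_
        filter_upwards [hφ] with x hx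
        have h1 := (ENNReal.continuous_rpow_const (y := t)).tendsto _ |>.comp hx
        -- Multiplication by `g x` may be discontinuous at `0` when `g x = ∞`; there the left side
        -- vanishes anyway.
        rcases eq_or_ne (rieszPotential α (fun y => ENNReal.ofReal (f y)) x ^ t) 0 with h0 | h0
        · rw [h0, mul_zero]; exact bot_le
        · exact (ENNReal.Tendsto.const_mul h1 (Or.inl h0)).liminf_eq.ge
    _ ≤ liminf (fun k => ∫⁻ x, g x *
          rieszPotential α (fun y => ENNReal.ofReal (F (φ k) y)) x ^ t) atTop :=
        lintegral_liminf_le' fun k => by have := hm (F (φ k)); fun_prop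
    _ ≤ L := by
        refine (liminf_le_liminf (Eventually.of_forall fun k => hF (φ k))).trans ?_
        simp

/-- The heart of the Fatou property: a single potential weight with energy at most `L ^ q` against
every `f j`, found as a common point of the nested sets `C j`. The strict bound in `hL` makes each
`C j` nonempty without any attainment of the infimum. -/
theorem nbarMetric_le_of_forall_lt (hs : 1 < s) (hα : 0 < α) (hαs : α < n / s) (hr : 0 < r)
    (hrs : r ≤ s) (hq : 1 < q) {f : ℕ → EuclideanSpace ℝ (Fin n) → ℝ≥0∞}
    {g : EuclideanSpace ℝ (Fin n) → ℝ≥0∞} (hf : ∀ j, AEMeasurable (f j) volume)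
    (hfg : ∀ᵐ x, Monotone (fun j => f j x) ∧ Tendsto (fun j => f j x) atTop (𝓝 (g x)))
    {L : ℝ≥0∞} (hL : ∀ j, nbarMetric α s r q (f j) < L) : nbarMetric α s r q g ≤ L := by
  have hs0 : 0 < s := by linarith
  have hq0 : 0 < q := by linarith
  have hfact : Fact (1 ≤ ENNReal.ofReal s) := ⟨by simpa using hs.le⟩
  have hneg : r * (1 - q) < 0 := mul_neg_of_pos_of_neg hr (by linarith)
  set C : ℕ → Set (Lp ℝ (ENNReal.ofReal s) (volume : Measure (EuclideanSpace ℝ (Fin n)))) :=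
    fun j => {F | 0 ≤ F} ∩ {F | ‖F‖ ≤ 1} ∩ {F | ∫⁻ x, f j x ^ q *
      rieszPotential α (fun y => ENNReal.ofReal (F y)) x ^ (r * (1 - q)) ≤ L ^ q} with hC
  have hFm : ∀ F : Lp ℝ (ENNReal.ofReal s) (volume : Measure (EuclideanSpace ℝ (Fin n))),
      AEMeasurable (fun y => ENNReal.ofReal (F y)) volume := fun F => by
    have hm := (Lp.aestronglyMeasurable F).aemeasurable
    fun_prop
  have hanti : Antitone C := antitone_nat_of_succ_le fun j F hF => by
    refine ⟨hF.1, le_trans (lintegral_mono_ae ?_) hF.2⟩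
    filter_upwards [hfg] with x hx
    have : f j x ≤ f (j + 1) x := hx.1 (Nat.le_succ j)
    gcongr
  have hclosed : ∀ j, IsClosed (C j) := fun j => by
    refine (isClosed_Ici.inter (isClosed_le continuous_norm continuous_const)).inter ?_
    exact isClosed_setOf_lintegral_rieszPotential_le hs hα hαs ((hf j).pow_const q) _
  have hne : ∀ j, (C j).Nonempty := by
    intro j
    obtain ⟨h, hhm, hhs, hhL⟩ := exists_of_nbarMetric_lt hs hα hαs hr hq (hL j)
    have hfin : ∀ᵐ x, h x < ∞ := by
      filter_upwards [ae_lt_top' (hhm.pow_const s) (hhs.trans_lt ENNReal.one_lt_top).ne] with x hx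
      exact (ENNReal.rpow_lt_top_iff_of_pos hs0).1 hx
    have heq : ∀ᵐ x, ‖(h x).toReal‖ₑ = h x := by
      filter_upwards [hfin] with x hx
      rw [Real.enorm_eq_ofReal ENNReal.toReal_nonneg, ENNReal.ofReal_toReal hx.ne]
    have hnorm : eLpNorm (fun x => (h x).toReal) (ENNReal.ofReal s) volume ≤ 1 := by
      rw [eLpNorm_eq_lintegral_rpow_enorm_toReal (by simpa using hs0) (by simp),
        ENNReal.toReal_ofReal hs0.le]
      refine ENNReal.rpow_le_one (le_trans (le_of_eq (lintegral_congr_ae ?_)) hhs) (by positivity)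
      filter_upwards [heq] with x hx
      rw [hx]
    have hmem : MemLp (fun x => (h x).toReal) (ENNReal.ofReal s) volume :=
      ⟨hhm.ennreal_toReal.aestronglyMeasurable, hnorm.trans_lt ENNReal.one_lt_top⟩
    refine ⟨hmem.toLp _, ⟨?_, ?_⟩, ?_⟩
    · refine (Lp.coeFn_nonneg _).1 ?_
      filter_upwards [hmem.coeFn_toLp] with x hx
      rw [hx]
      exact ENNReal.toReal_nonneg
    · rw [Set.mem_ofPred_eq, Lp.norm_toLp]
      exact ENNReal.toReal_le_of_le_ofReal zero_le_one (by simpa using hnorm)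
    · have hae : (fun y => ENNReal.ofReal (hmem.toLp _ y)) =ᵐ[volume] h := by
        filter_upwards [hmem.coeFn_toLp, hfin] with x hx hx'
        rw [hx, ENNReal.ofReal_toReal hx'.ne]
      rw [Set.mem_ofPred_eq]
      simp_rw [rieszPotential_congr_ae hae]
      have := ENNReal.rpow_le_rpow hhL.le hq0.le
      rwa [← ENNReal.rpow_mul, one_div_mul_cancel hq0.ne', ENNReal.rpow_one] at this
  have hsmul : ∀ F : Lp ℝ (ENNReal.ofReal s) (volume : Measure (EuclideanSpace ℝ (Fin n))),
      0 ≤ F → 0 ≤ (2⁻¹ : ℝ) • F := fun F hF => by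
    refine (Lp.coeFn_nonneg _).1 ?_
    filter_upwards [(Lp.coeFn_nonneg F).2 hF, Lp.coeFn_smul (2⁻¹ : ℝ) F] with x hx h1
    simp only [Pi.zero_apply] at hx
    rw [h1, Pi.smul_apply, Pi.zero_apply, smul_eq_mul]
    positivity
  have hmid : ∀ j, ∀ F ∈ C j, ∀ G ∈ C j, (2⁻¹ : ℝ) • F + (2⁻¹ : ℝ) • G ∈ C j := by
    rintro j F ⟨⟨hF0, hF1⟩, hF2⟩ G ⟨⟨hG0, hG1⟩, hG2⟩
    have hm1 := measurable_rieszPotential (α := α) (hFm F)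
    have hm2 := measurable_rieszPotential (α := α) (hFm G)
    have hm3 := hf j
    simp only [Set.mem_ofPred_eq] at hF0 hF1 hF2 hG0 hG1 hG2
    refine ⟨⟨add_nonneg (hsmul F hF0) (hsmul G hG0), ?_⟩, ?_⟩
    · refine (norm_add_le _ _).trans ?_
      rw [norm_smul, norm_smul, Real.norm_of_nonneg (by norm_num)]
      linarith
    · have hpot : ∀ x, rieszPotential α
          (fun y => ENNReal.ofReal (((2⁻¹ : ℝ) • F + (2⁻¹ : ℝ) • G) y)) x =
          2⁻¹ * rieszPotential α (fun y => ENNReal.ofReal (F y)) x +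
          2⁻¹ * rieszPotential α (fun y => ENNReal.ofReal (G y)) x := by
        intro x
        have hFm' := hFm F
        rw [← rieszPotential_const_mul (hFm F), ← rieszPotential_const_mul (hFm G),
          ← rieszPotential_add (by fun_prop)]
        refine rieszPotential_congr_ae ?_ x
        filter_upwards [(Lp.coeFn_nonneg F).2 hF0, (Lp.coeFn_nonneg G).2 hG0,
          Lp.coeFn_add ((2⁻¹ : ℝ) • F) ((2⁻¹ : ℝ) • G), Lp.coeFn_smul (2⁻¹ : ℝ) F,
          Lp.coeFn_smul (2⁻¹ : ℝ) G] with y hFy hGy h1 h2 h3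
        simp only [Pi.zero_apply] at hFy hGy
        rw [h1, Pi.add_apply, h2, h3, Pi.smul_apply, Pi.smul_apply, smul_eq_mul, smul_eq_mul,
          ENNReal.ofReal_add (by positivity) (by positivity), ENNReal.ofReal_mul (by norm_num),
          ENNReal.ofReal_mul (by norm_num), ENNReal.ofReal_inv_of_pos (by norm_num),
          ENNReal.ofReal_ofNat]
      rw [Set.mem_ofPred_eq]
      simp_rw [hpot]
      calc _ ≤ ∫⁻ x, (2⁻¹ * (f j x ^ q *
              rieszPotential α (fun y => ENNReal.ofReal (F y)) x ^ (r * (1 - q))) +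
            2⁻¹ * (f j x ^ q *
              rieszPotential α (fun y => ENNReal.ofReal (G y)) x ^ (r * (1 - q)))) := by
            refine lintegral_mono fun x => ?_
            refine (mul_le_mul' le_rfl (half_add_rpow_le hneg _ _)).trans (le_of_eq ?_)
            ring
        _ = 2⁻¹ * (∫⁻ x, f j x ^ q *
              rieszPotential α (fun y => ENNReal.ofReal (F y)) x ^ (r * (1 - q))) +
            2⁻¹ * ∫⁻ x, f j x ^ q *
              rieszPotential α (fun y => ENNReal.ofReal (G y)) x ^ (r * (1 - q)) := by
            rw [lintegral_add_left' (by fun_prop), lintegral_const_mul' _ _ (by simp),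
              lintegral_const_mul' _ _ (by simp)]
        _ ≤ 2⁻¹ * L ^ q + 2⁻¹ * L ^ q := by gcongr
        _ = L ^ q := by rw [← add_mul, ENNReal.inv_two_add_inv_two, one_mul]
  obtain ⟨F, hF⟩ := nonempty_iInter_of_uniformly_convex hanti hclosed hne hmid
    (φ := fun F => ‖F‖ ^ s) (fun F _ => by positivity)
    (fun F hF => Real.rpow_le_one (norm_nonneg _) hF.1.2 hs0.le)
    (fun η hη => by
      obtain ⟨δ, hδ, h⟩ := Lp_norm_rpow_uniformly_convex (μ := (volume : Measure (EuclideanSpace ℝ (Fin n))))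
        hs hη
      exact ⟨δ, hδ, fun x hx y hy hxy => h x y hx.1.1 hy.1.1 hx.1.2 hy.1.2 hxy⟩)
  have hFC := fun j => Set.mem_iInter.1 hF j
  have hF1 : ∫⁻ x, ENNReal.ofReal (F x) ^ s ≤ 1 := by
    have h1 : ‖F‖ ≤ 1 := (hFC 0).1.2
    calc _ ≤ ∫⁻ x, ‖F x‖ₑ ^ s := by
          refine lintegral_mono fun x => ENNReal.rpow_le_rpow ?_ hs0.le
          rw [Real.enorm_eq_ofReal_abs]
          exact ENNReal.ofReal_le_ofReal (le_abs_self _)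
      _ = ENNReal.ofReal (‖F‖ ^ s) := (ofReal_norm_rpow_eq_lintegral hs F).symm
      _ ≤ 1 := by
          rw [ENNReal.ofReal_le_one]
          exact Real.rpow_le_one (norm_nonneg _) h1 hs0.le
  refine (nbarMetric_le hs hα hαs hr hrs (hFm F) hF1).trans ?_
  have hm := measurable_rieszPotential (α := α) (hFm F)
  have hlim : ∫⁻ x, g x ^ q *
      rieszPotential α (fun y => ENNReal.ofReal (F y)) x ^ (r * (1 - q)) ≤ L ^ q := by
    have hT := lintegral_iSup' (μ := (volume : Measure (EuclideanSpace ℝ (Fin n))))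
      (f := fun j x => f j x ^ q *
        rieszPotential α (fun y => ENNReal.ofReal (F y)) x ^ (r * (1 - q)))
      (fun j => by have := hf j; fun_prop)
      (by
        filter_upwards [hfg] with x hx i j hij
        have : f i x ≤ f j x := hx.1 hij
        dsimp only
        gcongr)
    have heq : ∫⁻ x, g x ^ q *
        rieszPotential α (fun y => ENNReal.ofReal (F y)) x ^ (r * (1 - q)) =
        ∫⁻ x, ⨆ j, f j x ^ q *
        rieszPotential α (fun y => ENNReal.ofReal (F y)) x ^ (r * (1 - q)) := by
      refine lintegral_congr_ae ?_
      filter_upwards [hfg] with x hx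
      have hmono : Monotone fun j => f j x ^ q := fun i j hij =>
        ENNReal.rpow_le_rpow (hx.1 hij) hq0.le
      have h1 : Tendsto (fun j => f j x ^ q) atTop (𝓝 (g x ^ q)) :=
        (ENNReal.continuous_rpow_const.tendsto _).comp hx.2
      rw [← ENNReal.iSup_mul, tendsto_nhds_unique h1 (tendsto_atTop_iSup hmono)]
    -- With the weight fixed, monotone convergence turns the bounds for all `f j` into the bound for
    -- `g`.
    rw [heq, hT]
    exact iSup_le fun j => (hFC j).2
  refine (ENNReal.rpow_le_rpow hlim (by positivity)).trans ?_
  rw [← ENNReal.rpow_mul, mul_one_div_cancel hq0.ne', ENNReal.rpow_one]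

theorem nbarMetric_fatou (hs : 1 < s) (hα : 0 < α) (hαs : α < n / s) (hr : 0 < r)
    (hrs : r ≤ s) (hq : 1 < q) {f : ℕ → EuclideanSpace ℝ (Fin n) → ℝ≥0∞}
    {g : EuclideanSpace ℝ (Fin n) → ℝ≥0∞} (hf : ∀ j, AEMeasurable (f j) volume)
    (hfg : ∀ᵐ x, Monotone (fun j => f j x) ∧ Tendsto (fun j => f j x) atTop (𝓝 (g x))) :
    Monotone (fun j => nbarMetric α s r q (f j)) ∧
      Tendsto (fun j => nbarMetric α s r q (f j)) atTop (𝓝 (nbarMetric α s r q g)) := by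
  have hmono : Monotone (fun j => nbarMetric α s r q (f j)) := fun i j hij =>
    nbarMetric_mono_ae hq (by filter_upwards [hfg] with x hx using hx.1 hij)
  refine ⟨hmono, ?_⟩
  have heq : nbarMetric α s r q g = ⨆ j, nbarMetric α s r q (f j) := by
    -- Any `L` above the supremum strictly dominates every `nbarMetric` of `f j`, as the previous
    -- lemma requires; then `L` decreases to the supremum.
    refine le_antisymm (le_of_forall_gt_imp_ge_of_dense fun L hL => ?_) (iSup_le fun j => ?_)
    · exact nbarMetric_le_of_forall_lt hs hα hαs hr hrs hq hf hfg
        fun j => (le_iSup (fun j => nbarMetric α s r q (f j)) j).trans_lt hL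
    · refine nbarMetric_mono_ae hq ?_
      filter_upwards [hfg] with x hx using hx.1.ge_of_tendsto hx.2 j
  rw [heq]
  exact tendsto_atTop_iSup hmono

theorem isFunctionMetric_nbarMetric (hs : 1 < s) (hα : 0 < α) (hαs : α < n / s) (hr : 0 < r)
    (hrs : r ≤ s) (hq : 1 < q) : IsFunctionMetric (n := n) (nbarMetric α s r q) where
  eq_zero_iff _ hf := nbarMetric_eq_zero_iff hs hα hαs hr hrs hq hf
  add_le _ _ hf₁ _ := nbarMetric_add_le hs hα hαs hr hrs hq hf₁
  const_mul c f _ := nbarMetric_const_mul hs hα hαs hr hrs hq c f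
  fatou _ _ hf hfg := nbarMetric_fatou hs hα hαs hr hrs hq hf hfg
  indicator_lt_top _ hA _ := nbarMetric_indicator_lt_top hs hα hαs hr hrs hq hA
  setLIntegral_le _ hA _ := exists_setLIntegral_le_nbarMetric hs hα hαs hr hrs hq hA

end fatou

end RieszBFS

theorem mainTheorem10 (n : ℕ) (α s r p : ℝ) (hs : 1 < s) (hα : 0 < α) (hαs : α < n / s)
    (hr : 0 < r) (hrs : r ≤ s) (hp : 1 < p) :
    RieszBFS.IsBanachFunctionSpace (RieszBFS.nbarSpace n α s r (p / (p - 1)))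
      (RieszBFS.nbarNorm α s r (p / (p - 1))) ∧
    ∀ (f : ℕ → EuclideanSpace ℝ (Fin n) → ℝ) (g : EuclideanSpace ℝ (Fin n) → ℝ),
      (∀ j, AEMeasurable (f j) volume) → (∀ j x, 0 ≤ f j x) →
      (∀ᵐ x, Monotone (fun j => f j x) ∧ Tendsto (fun j => f j x) atTop (𝓝 (g x))) →
      Monotone (fun j => RieszBFS.nbarNorm α s r (p / (p - 1)) (f j)) ∧
      Tendsto (fun j => RieszBFS.nbarNorm α s r (p / (p - 1)) (f j)) atTop
        (𝓝 (RieszBFS.nbarNorm α s r (p / (p - 1)) g)) := by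
  have hq : 1 < p / (p - 1) := by rw [lt_div_iff₀ (by linarith)]; linarith
  refine ⟨⟨RieszBFS.nbarMetric α s r (p / (p - 1)),
    RieszBFS.isFunctionMetric_nbarMetric hs hα hαs hr hrs hq, rfl, fun _ _ => rfl⟩, ?_⟩
  intro f g hf hf0 hfg
  refine RieszBFS.nbarMetric_fatou hs hα hαs hr hrs hq (fun j => (hf j).enorm) ?_
  filter_upwards [hfg] with x hx
  refine ⟨fun i j hij => ?_, (continuous_enorm.tendsto _).comp hx.2⟩
  simp only [Real.enorm_eq_ofReal (hf0 _ x)]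
  exact ENNReal.ofReal_le_ofReal (hx.1 hij)
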